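/- **Proposition (type B Knuth classes).** Let $n\ge 0$ and let $B_n$ be the group of permutations $\pi$ of $\{-n,\dots,n\}$ with $\pi(-i)=-\pi(i)$; put $Des(\pi)=\{0\le i\le n-1 : \pi(i)>\pi(i+1)\}$. For $I\subseteq\{0,\dots,n-1\}$ let $$F^B_I=\sum_{\substack{0=i_0\le i_1\le\dots\le i_n\\ j\in I\Rightarrow i_j<i_{j+1}}}x_{i_1}x_{i_2}\cdots x_{i_n}$$ be Chow's type B fundamental quasisymmetric function in the variables $x_0,x_1,x_2,\dots$, and for $\mathcal B\subseteq B_n$ let $\mathcal Q(\mathcal B)=\sum_{\pi\in\mathcal B}F^B_{Des(\pi)}$. A *standard domino tableau* with $n$ dominoes is a tiling of a Young diagram $\lambda\vdash 2n$ by dominoes labelled $1,\dots,n$, each label being used once, such that the labels of distinct dominoes strictly increase along rows and down columns; $\lambda$ is its shape, and $\mathcal P^0(n)$ denotes the set of all shapes $\lambda\vdash 2n$ that occur. A *semistandard domino tableau* of shape $\lambda$ is a tiling of $\lambda$ by dominoes labelled with integers $\ge 0$ such that the labels of distinct dominoes weakly increase along rows and strictly increase down columns, and such that a vertical domino in the top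 left corner is not labelled $0$. The *domino function* is $\mathcal G_\lambda=\sum_T x_0^{\mu_0(T)}x_1^{\mu_1(T)}\cdots$, summed over the semistandard domino tableaux $T$ of shape $\lambda$, where $\mu_i(T)$ is the number of dominoes of $T$ labelled $i$. A set $\mathcal B\subseteq B_n$ is *$\mathcal G$-positive* if $\mathcal Q(\mathcal B)$ is a linear combination of the $\mathcal G_\lambda$, $\lambda\in\mathcal P^0(n)$, with non-negative coefficients. For $\pi\in B_n$ let $P_\pi$ be the first (insertion) tableau of the pair $(P_\pi,Q_\pi)$ that the Barbash–Vogan correspondence, in the form of Garfinkle's domino insertion, assigns to $\pi$. That is, $P_\pi$ arises from the empty tableau by inserting $\pi(1),\dots,\pi(n)$ in this order, where $a$ is inserted into $P$ as follows. Keep the dominoes of $P$ with label $<|a|$. Add a domino labelled $|a|$, horizontally at the end of the first row if $a>0$, vertically at the end of the first column if $a<0$. Then add back the dominoes $D$ of $P$ with label $>|a|$, in increasing order of their labels. When $D$ is added back, let $\gamma$ be the domino by which the current shape exceeds the shape formed in $P$ by the dominoes with smaller labels than $D$: if $D\cap\gamma=\emptyset$, then $D$ keeps its place; if $D\cap\gamma=\{(r,c)\}$,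 then $D$ is replaced by $(D\setminus\{(r,c)\})\cup\{(r+1,c+1)\}$; if $D=\gamma$ is horizontal (vertical), then $D$ moves to the end of the next row (next column) of the current shape, keeping its direction. Then for every standard domino tableau $T$ with $n$ dominoes, the type B Knuth class $$\mathcal C^B_T=\{\pi\in B_n : P_\pi=T\}$$ is $\mathcal G$-positive; more precisely, $\mathcal Q(\mathcal C^B_T)=\mathcal G_{shape(T)}$. -/

import Mathlib

namespace TypeBKnuth

/-! ### Signed permutations -/

/-- The hyperoctahedral group `B_n`: the permutations `π` of `{-n, …, -1, 0, 1, …, n}` such that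
`π (-i) = -π i` for all `i`. -/
def SignedPerm (n : ℕ) : Type :=
  {π : Equiv.Perm (Finset.Icc (-(n : ℤ)) n) //
    ∀ i j : Finset.Icc (-(n : ℤ)) n, (j : ℤ) = -(i : ℤ) → (π j : ℤ) = -(π i : ℤ)}

noncomputable instance (n : ℕ) : Fintype (SignedPerm n) :=
  Fintype.ofInjective (fun π : SignedPerm n => π.1) Subtype.val_injective

/-- The entry `π(i)` of a signed permutation, for `0 ≤ i ≤ n` (the value for `i > n` is
irrelevant). -/
noncomputable def SignedPerm.entry {n : ℕ} (π : SignedPerm n) (i : ℕ) : ℤ :=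
  if h : (i : ℤ) ∈ Finset.Icc (-(n : ℤ)) n then (π.1 ⟨(i : ℤ), h⟩ : ℤ) else 0

/-- `Des(π) = {0 ≤ i ≤ n - 1 | π(i) > π(i + 1)}`; recall `π(0) = 0`. -/
noncomputable def SignedPerm.descents {n : ℕ} (π : SignedPerm n) : Finset ℕ :=
  (Finset.range n).filter fun i => π.entry (i + 1) < π.entry i

/-! ### Generating functions in the alphabet `x_0, x_1, x_2, …` -/

/-- The formal power series `∑_{a ∈ S} x^{w(a)}`: the coefficient of the monomial `x^m` is the
number of `a ∈ S` of weight `m`. (It is only used for families all of whose weight classes are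
finite, see the two finiteness lemmas below.) -/
noncomputable def genFun {α : Type} (S : Set α) (w : α → ℕ →₀ ℕ) : MvPowerSeries ℕ ℂ :=
  fun m => (({a | a ∈ S ∧ w a = m} : Set α).ncard : ℂ)

/-- The index sequences `0 = i_0 ≤ i_1 ≤ … ≤ i_n` with `i_j < i_{j+1}` for all `j ∈ I`. -/
def chowSequences (n : ℕ) (I : Finset ℕ) : Set (Fin (n + 1) → ℕ) :=
  {i | i 0 = 0 ∧ (∀ j : Fin n, i j.castSucc ≤ i j.succ) ∧
    ∀ j : Fin n, (j : ℕ) ∈ I → i j.castSucc < i j.succ}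

/-- The exponent of the monomial `x_{i_1} x_{i_2} ⋯ x_{i_n}`. -/
noncomputable def sequenceWeight {n : ℕ} (i : Fin (n + 1) → ℕ) : ℕ →₀ ℕ :=
  ∑ j : Fin n, Finsupp.single (i j.succ) 1

/-- Chow's type B fundamental quasisymmetric function `F^B_I`, for `I ⊆ {0, …, n - 1}`. -/
noncomputable def chowF (n : ℕ) (I : Finset ℕ) : MvPowerSeries ℕ ℂ :=
  genFun (chowSequences n I) sequenceWeight

open scoped Classical in
/-- `𝒬(B) = ∑_{π ∈ B} F^B_{Des(π)}` for a set `B` of signed permutations. -/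
noncomputable def quasisym {n : ℕ} (B : Set (SignedPerm n)) : MvPowerSeries ℕ ℂ :=
  ∑ π ∈ Finset.univ.filter (fun π => π ∈ B), chowF n π.descents

/-! ### Domino tableaux -/

/-- A domino, given by its top left cell `(row, col)` and its direction. Rows and columns are
numbered from `0`, from top to bottom and from left to right. -/
structure Domino where
  row : ℕ
  col : ℕ
  vertical : Bool
deriving DecidableEq

/-- The two cells of a domino. -/
def Domino.cells (D : Domino) : Finset (ℕ × ℕ) :=
  {(D.row, D.col), if D.vertical then (D.row + 1, D.col) else (D.row, D.col + 1)}

/-- A finite collection of labelled dominoes. -/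
abbrev Filling : Type := Finset (Domino × ℕ)

/-- The dominoes of `T` tile the Young diagram `lam`: they lie in `lam`, and each cell of `lam` lies
in exactly one of them. -/
def Tiles (T : Filling) (lam : YoungDiagram) : Prop :=
  (∀ p ∈ T, p.1.cells ⊆ lam.cells) ∧ ∀ c ∈ lam.cells, ∃! p, p ∈ T ∧ c ∈ p.1.cells

/-- `T` is a standard domino tableau of shape `lam` (with `n` dominoes): the dominoes tile `lam`,
they carry the labels `1, …, n`, each exactly once, and the labels of distinct dominoes increase
strictly along the rows and down the columns. -/
structure IsStandard (n : ℕ) (lam : YoungDiagram) (T : Filling) : Prop where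
  tiles : Tiles T lam
  label_mem : ∀ p ∈ T, p.2 ∈ Finset.Icc 1 n
  label_unique : ∀ k ∈ Finset.Icc 1 n, ∃! p, p ∈ T ∧ p.2 = k
  row_lt : ∀ p ∈ T, ∀ q ∈ T, p ≠ q → ∀ c ∈ p.1.cells, ∀ d ∈ q.1.cells,
    c.1 = d.1 → c.2 < d.2 → p.2 < q.2
  col_lt : ∀ p ∈ T, ∀ q ∈ T, p ≠ q → ∀ c ∈ p.1.cells, ∀ d ∈ q.1.cells,
    c.2 = d.2 → c.1 < d.1 → p.2 < q.2

/-- `T` is a semistandard domino tableau of shape `lam`: the dominoes tile `lam` and carry labels in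
`{0, 1, 2, …}` that weakly increase along the rows and strictly increase down the columns (for
distinct dominoes); moreover a vertical domino in the top left corner is not labelled `0`. -/
structure IsSemistandard (lam : YoungDiagram) (T : Filling) : Prop where
  tiles : Tiles T lam
  row_le : ∀ p ∈ T, ∀ q ∈ T, p ≠ q → ∀ c ∈ p.1.cells, ∀ d ∈ q.1.cells,
    c.1 = d.1 → c.2 < d.2 → p.2 ≤ q.2
  col_lt : ∀ p ∈ T, ∀ q ∈ T, p ≠ q → ∀ c ∈ p.1.cells, ∀ d ∈ q.1.cells,
    c.2 = d.2 → c.1 < d.1 → p.2 < q.2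
  corner : (⟨0, 0, true⟩, 0) ∉ T

/-- The set `𝒫⁰(n)` of partitions of `2n` with empty 2-core, i.e. those that admit a standard domino
tableau. -/
def emptyCorePartitions (n : ℕ) : Set YoungDiagram :=
  {lam | lam.card = 2 * n ∧ ∃ T, IsStandard n lam T}

/-- The weight `μ` of a labelled filling: `μ_i` is the number of dominoes labelled `i`. -/
noncomputable def Filling.weight (T : Filling) : ℕ →₀ ℕ :=
  ∑ p ∈ T, Finsupp.single p.2 1

/-- The domino function `𝒢_lam = ∑_{T ∈ SSDT(lam)} X^T`. -/
noncomputable def dominoFunction (lam : YoungDiagram) : MvPowerSeries ℕ ℂ :=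
  genFun {T | IsSemistandard lam T} Filling.weight

/-- A set `B ⊆ B_n` is `𝒢`-positive if `𝒬(B)` is a linear combination of the domino functions
`𝒢_lam`, `lam ∈ 𝒫⁰(n)`, with non-negative coefficients. -/
def GPositive {n : ℕ} (B : Set (SignedPerm n)) : Prop :=
  ∃ c : YoungDiagram →₀ NNReal, (c.support : Set YoungDiagram) ⊆ emptyCorePartitions n ∧
    quasisym B = c.sum fun lam a => ((a : ℝ) : ℂ) • dominoFunction lam

/-! ### The domino Robinson–Schensted correspondence of Barbash–Vogan and Garfinkle -/

/-- The set of cells covered by a filling. -/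
def Filling.cells (T : Filling) : Finset (ℕ × ℕ) := T.biUnion fun p => p.1.cells

/-- The length of row `i` of a set of cells. -/
def rowLength (S : Finset (ℕ × ℕ)) (i : ℕ) : ℕ := (S.filter fun c => c.1 = i).card

/-- The length of column `j` of a set of cells. -/
def colLength (S : Finset (ℕ × ℕ)) (j : ℕ) : ℕ := (S.filter fun c => c.2 = j).card

/-- The horizontal domino at the end of row `i` of the shape `S`. -/
def rowEnd (S : Finset (ℕ × ℕ)) (i : ℕ) : Domino := ⟨i, rowLength S i, false⟩

/-- The vertical domino at the end of column `j` of the shape `S`. -/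
def colEnd (S : Finset (ℕ × ℕ)) (j : ℕ) : Domino := ⟨colLength S j, j, true⟩

/-- The bumping rule. A domino `D` that was added to the shape `A` is to be added to the
larger shape `B`, which is `A` together with one domino `B \ A`:
* if `D` does not meet `B \ A`, it stays in its place;
* if `D = B \ A`, it is bumped to the end of the next row (if it is horizontal) or to the end of the
  next column (if it is vertical) of `B`;
* otherwise `D` and `B \ A` have different directions and exactly their top left cell `(r, c)` in
  common, and `D` is turned around: `D ∖ {(r, c)} ∪ {(r + 1, c + 1)}`. -/
def bump (A B : Finset (ℕ × ℕ)) (D : Domino) : Domino :=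
  if Disjoint D.cells (B \ A) then D
  else if D.cells = B \ A then
    if D.vertical then colEnd B (D.col + 1) else rowEnd B (D.row + 1)
  else if D.vertical then ⟨D.row + 1, D.col, false⟩ else ⟨D.row, D.col + 1, true⟩

/-- Transfer the domino labelled `y` (if there is one) from the old tableau `T` to the tableau `U`
under construction, which holds the dominoes with labels `< y` after the insertion. -/
def transfer (T U : Filling) (y : ℕ) : Filling :=
  U ∪ (T.filter fun p => p.2 = y).image fun p =>
    (bump (Filling.cells (T.filter fun q => q.2 < y)) (Filling.cells U) p.1, y)

/-- Insertion of the letter `a` (with `1 ≤ |a| ≤ n`) into the tableau `T`: keep the dominoes with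
labels smaller than `x = |a|`, add a domino labelled `x`, horizontally at the end of the first row
if `a > 0` and vertically at the end of the first column if `a < 0`, and then add the dominoes
with labels `x + 1, …, n` of `T`, in this order, by the bumping rule. -/
def insertLetter (n : ℕ) (T : Filling) (a : ℤ) : Filling :=
  let x := a.natAbs
  let T₀ : Filling := T.filter fun p => p.2 < x
  let D : Domino := if 0 < a then rowEnd (Filling.cells T₀) 0 else colEnd (Filling.cells T₀) 0
  (List.range' (x + 1) (n - x)).foldl (transfer T) (insert (D, x) T₀)

/-- The insertion tableau of a word, whose letters are inserted from left to right. -/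
def insertWord (n : ℕ) (w : List ℤ) : Filling := w.foldl (insertLetter n) ∅

/-- The insertion tableau `P_π` of `π ∈ B_n`: insert `π(1), π(2), …, π(n)`. -/
noncomputable def SignedPerm.insertionTableau {n : ℕ} (π : SignedPerm n) : Filling :=
  insertWord n ((List.range n).map fun i => π.entry (i + 1))

/-- The type B Knuth class `{π ∈ B_n | P_π = T}`. -/
def knuthClass (n : ℕ) (T : Filling) : Set (SignedPerm n) := {π | π.insertionTableau = T}

/-! ### Finiteness of the weight classes -/

theorem chowSequences_finite (n : ℕ) (I : Finset ℕ) (m : ℕ →₀ ℕ) :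
    {i | i ∈ chowSequences n I ∧ sequenceWeight i = m}.Finite := by
  refine (Set.Finite.pi' (t := fun _ : Fin (n + 1) => (insert 0 m.support : Finset ℕ))
    fun _ => Finset.finite_toSet _).subset ?_
  rintro i ⟨⟨h0, -⟩, rfl⟩ j
  refine Fin.cases ?_ (fun k => ?_) j
  · simp [h0]
  · have h : 1 ≤ sequenceWeight i (i k.succ) := by
      unfold sequenceWeight
      rw [Finsupp.finsetSum_apply]
      refine le_trans (by simp) (Finset.single_le_sum (f := fun j : Fin n =>
        (Finsupp.single (i j.succ) 1 : ℕ →₀ ℕ) (i k.succ)) (fun _ _ => Nat.zero_le _)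
        (Finset.mem_univ k))
    simp only [Finset.coe_insert, Set.mem_insert_iff, Finset.mem_coe, Finsupp.mem_support_iff]
    right
    omega

theorem semistandard_finite (lam : YoungDiagram) (m : ℕ →₀ ℕ) :
    {T | IsSemistandard lam T ∧ Filling.weight T = m}.Finite := by
  let S : Finset (Domino × ℕ) := (lam.cells ×ˢ (Finset.univ : Finset Bool) ×ˢ m.support).image
    fun t => (⟨t.1.1, t.1.2, t.2.1⟩, t.2.2)
  refine (Finset.finite_toSet S.powerset).subset ?_
  rintro T ⟨hT, rfl⟩
  rw [Finset.mem_coe, Finset.mem_powerset]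
  intro p hp
  have h1 : (p.1.row, p.1.col) ∈ lam.cells := hT.tiles.1 p hp (by simp [Domino.cells])
  have h2 : 1 ≤ Filling.weight T p.2 := by
    unfold Filling.weight
    rw [Finsupp.finsetSum_apply]
    refine le_trans (by simp) (Finset.single_le_sum (f := fun q : Domino × ℕ =>
      (Finsupp.single q.2 1 : ℕ →₀ ℕ) p.2) (fun _ _ => Nat.zero_le _) hp)
  refine Finset.mem_image.2 ⟨((p.1.row, p.1.col), p.1.vertical, p.2), ?_, rfl⟩
  simp only [Finset.mem_product, Finset.mem_univ, true_and, Finsupp.mem_support_iff]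
  exact ⟨h1, by omega⟩

end TypeBKnuth

/-! The argument takes place on the boundary of a shape, read as a bead configuration: row `r` puts
a bead at (its length) minus `r`, and the gaps belong to the columns. Adding a domino of either
direction moves one bead from `d` to `d + 2` (`Addable.beads_union`), where `d` is the smaller
content of its two cells, and `d` determines the domino (`Addable.eq_of_diag`). A standard tableau
thus becomes a sequence of moves. The bumping rule becomes a local rule. A domino whose move differs
from the current growth of the shape keeps its move, even if it is turned around
(`bump_of_diag_ne`). Only equal moves collide, and then the new move is found at the next bead to
the left or at the next gap to the right (`bump_self`).

The collision rule is invertible, and its inverse fails exactly at the rightmost bead and the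
leftmost gap, that is, where a positive or a negative letter enters. So insertion can be undone in
exactly one way (`exists_reverse_moveInsert`, `MoveInsert.unique`), and words correspond to pairs of
tableaux of the same shape. For a fixed insertion tableau, the recording tableaux run exactly once
through all standard tableaux of its shape.

Descents can be read off the recording tableau: consecutive letters compare as their moves do
(`MoveInsert.lt_iff`), and the first letter is negative exactly when the first move is -1, that is,
when the first domino is vertical.

Finally, a sequence contributing to Chow's function of the descent set is a labelling of the
recording tableau. It yields a semistandard tableau, which is standardised by ordering its dominoes
by label and, for equal labels, by content (`exists_sortedGrowth`, `IsSortedGrowth.isOrdered`). The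
condition at position 0 is the condition on the top left corner. Hence pairs of a permutation in the
class and a sequence correspond, with equal weights, to semistandard tableaux, and one domino
function with coefficient 1 results. -/

namespace TypeBKnuth

/-! ### Bead configurations -/

/-- Move the bead at position `e` two steps to the right. -/
def moveBead (s : Set ℤ) (e : ℤ) : Set ℤ := {x | x = e + 2 ∨ x ∈ s ∧ x ≠ e}

/-- The bead at position `e` can be moved two steps to the right. -/
def Movable (s : Set ℤ) (e : ℤ) : Prop := e ∈ s ∧ e + 2 ∉ s

/-- The bead configuration of the empty shape. -/
def vacuum : Set ℤ := {x | x ≤ 0}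

theorem mem_moveBead {s : Set ℤ} {e x : ℤ} : x ∈ moveBead s e ↔ x = e + 2 ∨ x ∈ s ∧ x ≠ e :=
  Iff.rfl

/-- The collision rule: the move `e` on the configuration `s` is already taken, and it is replaced
by `p`. -/
def NextMove (s : Set ℤ) (e p : ℤ) : Prop :=
  (e + 1 ∉ s ∧ p ∈ s ∧ p < e ∧ ∀ x, p < x → x < e → x ∉ s) ∨
    (e + 1 ∈ s ∧ p + 2 ∉ s ∧ e < p ∧ ∀ x, e + 2 < x → x < p + 2 → x ∈ s)

/-- The inverse of the collision rule. -/
def PrevMove (s : Set ℤ) (p e : ℤ) : Prop :=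
  (p + 1 ∉ s ∧ e + 2 ∈ s ∧ p < e + 2 ∧ ∀ x, p < x → x < e + 2 → x ∉ s) ∨
    (p + 1 ∈ s ∧ e ∉ s ∧ e < p + 2 ∧ ∀ x, e < x → x < p + 2 → x ∈ s)

/-- All positions far to the left are occupied, and all positions far to the right are empty. -/
def Bounded (s : Set ℤ) : Prop := ∃ k : ℤ, (∀ x, x < -k → x ∈ s) ∧ ∀ x, k < x → x ∉ s

theorem bounded_vacuum : Bounded vacuum := ⟨1, by simp only [vacuum, Set.mem_ofPred_eq]; grind⟩

theorem Bounded.moveBead {s : Set ℤ} (h : Bounded s) (e : ℤ) : Bounded (moveBead s e) := by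
  obtain ⟨k, h1, h2⟩ := h
  refine ⟨|k| + |e| + 2, fun x hx => ?_, fun x hx => ?_⟩
  · have := h1 x
    rw [mem_moveBead]
    grind
  · have := h2 x
    rw [mem_moveBead]
    grind

theorem exists_greatest {P : ℤ → Prop} (h : ∃ x, P x) (b : ℤ) (hb : ∀ x, P x → x ≤ b) :
    ∃ m, P m ∧ ∀ x, P x → x ≤ m := by
  classical
  obtain ⟨m, h1, h2⟩ := Int.exists_greatest_of_bdd ⟨b, hb⟩ h
  exact ⟨m, h1, h2⟩

theorem exists_least {P : ℤ → Prop} (h : ∃ x, P x) (b : ℤ) (hb : ∀ x, P x → b ≤ x) :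
    ∃ m, P m ∧ ∀ x, P x → m ≤ x := by
  classical
  obtain ⟨m, h1, h2⟩ := Int.exists_least_of_bdd ⟨b, hb⟩ h
  exact ⟨m, h1, h2⟩

theorem Bounded.exists_max {s : Set ℤ} (h : Bounded s) : ∃ m ∈ s, ∀ x ∈ s, x ≤ m := by
  obtain ⟨k, h1, h2⟩ := h
  exact exists_greatest ⟨-k - 1, h1 _ (by omega)⟩ k fun x hx => by
    by_contra hk; exact h2 x (by omega) hx

theorem Bounded.exists_min {s : Set ℤ} (h : Bounded s) : ∃ m, m ∉ s ∧ ∀ x, x ∉ s → m ≤ x := by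
  obtain ⟨k, h1, h2⟩ := h
  exact exists_least ⟨k + 1, h2 _ (by omega)⟩ (-k) fun x hx => by
    by_contra hk; exact hx (h1 x (by omega))

/-- Beads exist arbitrarily far to the left and gaps arbitrarily far to the right, so the search
started by a collision always ends. -/
theorem Bounded.exists_nextMove {s : Set ℤ} (h : Bounded s) (e : ℤ) : ∃ p, NextMove s e p := by
  obtain ⟨k, h1, h2⟩ := h
  by_cases he : e + 1 ∈ s
  · obtain ⟨q, ⟨hq, hqs⟩, hmin⟩ := exists_least (P := fun x => e + 2 < x ∧ x ∉ s)
      ⟨max (k + 1) (e + 3), by grind, h2 _ (by grind)⟩ (e + 2) (by grind)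
    refine ⟨q - 2, Or.inr ⟨he, by simpa using hqs, by omega, fun x hx hxq => ?_⟩⟩
    by_contra hxs
    have := hmin x ⟨hx, hxs⟩
    omega
  · obtain ⟨q, ⟨hq, hqs⟩, hmax⟩ := exists_greatest (P := fun x => x < e ∧ x ∈ s)
      ⟨min (-k - 1) (e - 1), by grind, h1 _ (by grind)⟩ e (by grind)
    refine ⟨q, Or.inl ⟨he, hqs, hq, fun x hx hxq hxs => ?_⟩⟩
    have := hmax x ⟨hxq, hxs⟩
    omega

/-! ### The collision rule is a bijection -/

theorem NextMove.unique {s : Set ℤ} {e p q : ℤ} (h : NextMove s e p) (h' : NextMove s e q) :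
    p = q := by
  rcases h with ⟨a, b, c, d⟩ | ⟨a, b, c, d⟩ <;> rcases h' with ⟨a', b', c', d'⟩ | ⟨a', b', c', d'⟩
  · rcases lt_trichotomy p q with h | h | h
    · exact absurd b' (d _ h c')
    · exact h
    · exact absurd b (d' _ h c)
  · exact absurd a' a
  · exact absurd a a'
  · rcases lt_trichotomy p q with h | h | h
    · exact absurd (d' _ (by omega) (by omega)) b
    · exact h
    · exact absurd (d _ (by omega) (by omega)) b'

theorem NextMove.movable {s : Set ℤ} {e p : ℤ} (he : Movable s e) (h : NextMove s e p) :
    Movable (moveBead s e) p := by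
  obtain ⟨h1, h2⟩ := he
  simp only [Movable, mem_moveBead]
  rcases h with ⟨a, b, c, d⟩ | ⟨a, b, c, d⟩
  · refine ⟨Or.inr ⟨b, by omega⟩, ?_⟩
    rintro (h | ⟨h, h'⟩)
    · omega
    · by_cases h3 : p + 2 < e
      · exact d _ (by omega) h3 h
      · have : p + 2 = e + 1 := by omega
        exact a (this ▸ h)
  · refine ⟨?_, ?_⟩
    · by_cases h3 : p = e + 1
      · exact Or.inr ⟨h3 ▸ a, by omega⟩
      · by_cases h4 : p = e + 2
        · exact Or.inl h4
        · exact Or.inr ⟨d _ (by omega) (by omega), by omega⟩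
    · rintro (h | ⟨h, h'⟩)
      · omega
      · exact b h

/-- The direction of a collision stays visible afterwards: `p + 1` is a gap of the new configuration
if the search went left, and a bead if it went right. Hence the inverse rule knows which way to
search. -/
theorem NextMove.prevMove {s : Set ℤ} {e p : ℤ} (he : Movable s e) (h : NextMove s e p) :
    PrevMove (moveBead s e) p e := by
  obtain ⟨h1, h2⟩ := he
  simp only [PrevMove, mem_moveBead]
  rcases h with ⟨a, b, c, d⟩ | ⟨a, b, c, d⟩
  · left
    have key : ∀ x, p < x → x < e + 2 → ¬ (x = e + 2 ∨ x ∈ s ∧ x ≠ e) := by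
      rintro x hx hx2 (h | ⟨h, h'⟩)
      · omega
      · by_cases h3 : x < e
        · exact d _ hx h3 h
        · have : x = e + 1 := by omega
          exact a (this ▸ h)
    exact ⟨key _ (by omega) (by omega), Or.inl trivial, by omega, key⟩
  · right
    have key : ∀ x, e < x → x < p + 2 → (x = e + 2 ∨ x ∈ s ∧ x ≠ e) := by
      intro x hx hx2
      by_cases h3 : x = e + 1
      · exact Or.inr ⟨h3 ▸ a, by omega⟩
      · by_cases h4 : x = e + 2
        · exact Or.inl h4
        · exact Or.inr ⟨d _ (by omega) (by omega), by omega⟩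
    refine ⟨key _ (by omega) (by omega), by omega, by omega, key⟩

/-- A bead at `e + 2` and a gap at `e` are what is needed to undo the move `e`, so reverse insertion
can continue with the smaller labels. -/
theorem PrevMove.removable {s : Set ℤ} {e p : ℤ} (hp : Movable s p) (h : PrevMove s p e) :
    e + 2 ∈ s ∧ e ∉ s := by
  obtain ⟨h1, h2⟩ := hp
  rcases h with ⟨a, b, c, d⟩ | ⟨a, b, c, d⟩
  · refine ⟨b, ?_⟩
    have h3 : e ≠ p := by rintro rfl; exact h2 b
    have h4 : e + 2 ≠ p + 1 := fun h => a (h ▸ b)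
    exact d _ (by omega) (by omega)
  · refine ⟨?_, b⟩
    have h3 : e ≠ p := by rintro rfl; exact b h1
    have h4 : e ≠ p + 1 := by rintro rfl; exact b a
    exact d _ (by omega) (by omega)

theorem PrevMove.nextMove {s : Set ℤ} {e p : ℤ} (he : Movable s e)
    (hp : Movable (moveBead s e) p) (h : PrevMove (moveBead s e) p e) : NextMove s e p := by
  obtain ⟨h1, h2⟩ := hp
  obtain ⟨h5, h6⟩ := he
  simp only [PrevMove, mem_moveBead] at h h1 h2
  rcases h with ⟨a, b, c, d⟩ | ⟨a, b, c, d⟩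
  · have h3 : e ≠ p := by grind
    have h4 : e ≠ p - 1 := by grind
    left
    refine ⟨fun h => d (e + 1) (by omega) (by omega) (Or.inr ⟨h, by omega⟩), by grind, by omega,
      fun x hx hx' h => d x hx (by omega) (Or.inr ⟨h, by omega⟩)⟩
  · have h3 : e ≠ p := by grind
    have h4 : e ≠ p + 1 := by grind
    right
    refine ⟨by grind, by grind, by omega, fun x hx hx' => ?_⟩
    have := d x (by omega) hx'
    grind

theorem PrevMove.unique {s : Set ℤ} {p e e' : ℤ} (h : PrevMove s p e) (h' : PrevMove s p e') :
    e = e' := by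
  rcases h with ⟨a, b, c, d⟩ | ⟨a, b, c, d⟩ <;> rcases h' with ⟨a', b', c', d'⟩ | ⟨a', b', c', d'⟩
  · rcases lt_trichotomy e e' with h | h | h
    · exact absurd b (d' _ (by omega) (by omega))
    · exact h
    · exact absurd b' (d _ (by omega) (by omega))
  · exact absurd a' a
  · exact absurd a a'
  · rcases lt_trichotomy e e' with h | h | h
    · exact absurd (d _ h (by omega)) b'
    · exact h
    · exact absurd (d' _ h (by omega)) b

/-! ### Insertion in terms of bead moves -/

/-- A tableau, encoded by the moves of its dominoes: the entry at the head belongs to the largest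
label, which is the length of the list. -/
abbrev MoveTableau := List (Option ℤ)

/-- The bead configuration of the shape of a tableau. -/
def beadShape : MoveTableau → Set ℤ
  | [] => vacuum
  | none :: t => beadShape t
  | some d :: t => moveBead (beadShape t) d

/-- All moves of a tableau are possible. -/
def ValidMoves : MoveTableau → Prop
  | [] => True
  | none :: t => ValidMoves t
  | some d :: t => ValidMoves t ∧ Movable (beadShape t) d

/-- The labels that occur in a tableau. -/
def labelSet : MoveTableau → Finset ℕ
  | [] => ∅
  | none :: t => labelSet t
  | some _ :: t => insert (t.length + 1) (labelSet t)

/-- The insertion of the letter `a` into `t` yields `t'`, and the shape grows by the move `e`. -/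
inductive MoveInsert : MoveTableau → ℤ → MoveTableau → ℤ → Prop
  | pos (t : MoveTableau) (m : ℤ) (hm : m ∈ beadShape t) (hmax : ∀ x ∈ beadShape t, x ≤ m) :
      MoveInsert (none :: t) (t.length + 1) (some m :: t) m
  | neg (t : MoveTableau) (m : ℤ) (hm : m + 2 ∉ beadShape t)
      (hmin : ∀ x, x ∉ beadShape t → m + 2 ≤ x) :
      MoveInsert (none :: t) (-(t.length + 1)) (some m :: t) m
  | skip {t t' : MoveTableau} {a e : ℤ} (h : MoveInsert t a t' e) :
      MoveInsert (none :: t) a (none :: t') e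
  | keep {t t' : MoveTableau} {a e : ℤ} (d : ℤ) (h : MoveInsert t a t' e) (hd : d ≠ e) :
      MoveInsert (some d :: t) a (some d :: t') e
  | collide {t t' : MoveTableau} {a e : ℤ} (p : ℤ) (h : MoveInsert t a t' e)
      (hp : NextMove (beadShape t) e p) :
      MoveInsert (some e :: t) a (some p :: t') p

theorem bounded_beadShape (t : MoveTableau) : Bounded (beadShape t) := by
  induction t with
  | nil => exact bounded_vacuum
  | cons x t ih => cases x with
    | none => exact ih
    | some d => exact ih.moveBead d

/-- Two movable beads are never at distance 2, since the target of one would be occupied by the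
other; so distinct moves do not interfere. This is the local square behind `MoveInsert.keep`. -/
theorem moveBead_comm {s : Set ℤ} {d e : ℤ} (hd : Movable s d) (he : Movable s e) (hne : d ≠ e) :
    Movable (moveBead s d) e ∧ moveBead (moveBead s d) e = moveBead (moveBead s e) d := by
  obtain ⟨h1, h2⟩ := hd
  obtain ⟨h3, h4⟩ := he
  have h5 : d ≠ e + 2 := by rintro rfl; exact h4 h1
  have h6 : e ≠ d + 2 := by rintro rfl; exact h2 h3
  refine ⟨⟨Or.inr ⟨h3, hne.symm⟩, by rintro (h | ⟨h, -⟩); exacts [hne (by omega), h4 h]⟩, ?_⟩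
  ext x
  simp only [mem_moveBead]
  grind

theorem MoveInsert.length_eq {t t' : MoveTableau} {a e : ℤ} (h : MoveInsert t a t' e) :
    t'.length = t.length := by
  induction h <;> simp_all

theorem MoveInsert.natAbs_le {t t' : MoveTableau} {a e : ℤ} (h : MoveInsert t a t' e) :
    1 ≤ a.natAbs ∧ a.natAbs ≤ t.length := by
  induction h <;> simp_all <;> omega

theorem labelSet_subset (t : MoveTableau) : ∀ x ∈ labelSet t, 1 ≤ x ∧ x ≤ t.length := by
  induction t with
  | nil => simp [labelSet]
  | cons x t ih => cases x with
    | none => intro x hx; have := ih x hx; simp; omega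
    | some d =>
      intro x hx
      simp only [labelSet, Finset.mem_insert] at hx
      rcases hx with rfl | hx
      · simp
      · have := ih x hx; simp; omega

theorem MoveInsert.labelSet_eq {t t' : MoveTableau} {a e : ℤ} (h : MoveInsert t a t' e) :
    a.natAbs ∉ labelSet t ∧ labelSet t' = insert a.natAbs (labelSet t) := by
  induction h with
  | pos t m hm hmax =>
    have h1 : ((t.length : ℤ) + 1).natAbs = t.length + 1 := by omega
    refine ⟨fun h => ?_, ?_⟩
    · have := labelSet_subset _ _ (show _ ∈ labelSet t from h)
      omega
    · rw [h1]; rfl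
  | neg t m hm hmax =>
    have h1 : (-((t.length : ℤ) + 1)).natAbs = t.length + 1 := by omega
    refine ⟨fun h => ?_, ?_⟩
    · have := labelSet_subset _ _ (show _ ∈ labelSet t from h)
      omega
    · rw [h1]; rfl
  | skip h ih => exact ih
  | keep d h hd ih =>
    have := h.natAbs_le
    simp only [labelSet, Finset.mem_insert, not_or, h.length_eq, ih.2]
    exact ⟨⟨by omega, ih.1⟩, Finset.insert_comm _ _ _⟩
  | collide p h hp ih =>
    have := h.natAbs_le
    simp only [labelSet, Finset.mem_insert, not_or, h.length_eq, ih.2]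
    exact ⟨⟨by omega, ih.1⟩, Finset.insert_comm _ _ _⟩

theorem movable_max {s : Set ℤ} {m : ℤ} (hm : m ∈ s) (hmax : ∀ x ∈ s, x ≤ m) : Movable s m :=
  ⟨hm, fun h => by have := hmax _ h; omega⟩

theorem movable_min {s : Set ℤ} {m : ℤ} (hm : m + 2 ∉ s) (hmin : ∀ x, x ∉ s → m + 2 ≤ x) :
    Movable s m :=
  ⟨by by_contra h; have := hmin _ h; omega, hm⟩

/-- For each label the old and the new shapes form a square: it commutes by `moveBead_comm` if the
moves differ, and after a collision both ways around perform `e` and then `p`. -/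
theorem MoveInsert.valid {t t' : MoveTableau} {a e : ℤ} (h : MoveInsert t a t' e)
    (ht : ValidMoves t) :
    ValidMoves t' ∧ Movable (beadShape t) e ∧ beadShape t' = moveBead (beadShape t) e := by
  induction h with
  | pos t m hm hmax => exact ⟨⟨ht, movable_max hm hmax⟩, movable_max hm hmax, rfl⟩
  | neg t m hm hmin => exact ⟨⟨ht, movable_min hm hmin⟩, movable_min hm hmin, rfl⟩
  | skip h ih => exact ih ht
  | @keep t t' a e d h hd ih =>
    obtain ⟨ht, hdt⟩ := ht
    obtain ⟨h1, h2, h3⟩ := ih ht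
    refine ⟨⟨h1, ?_⟩, (moveBead_comm hdt h2 hd).1, ?_⟩
    · rw [h3]; exact (moveBead_comm h2 hdt hd.symm).1
    · simp only [beadShape, h3]
      exact (moveBead_comm h2 hdt hd.symm).2
  | collide p h hp ih =>
    obtain ⟨ht, hdt⟩ := ht
    obtain ⟨h1, h2, h3⟩ := ih ht
    refine ⟨⟨h1, ?_⟩, hp.movable h2, ?_⟩
    · rw [h3]; exact hp.movable h2
    · simp only [beadShape, h3]

theorem exists_moveInsert (t : MoveTableau) (a : ℤ) (h1 : 1 ≤ a.natAbs) (h2 : a.natAbs ≤ t.length)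
    (h3 : a.natAbs ∉ labelSet t) : ∃ t' e, MoveInsert t a t' e := by
  induction t with
  | nil => simp at h2; omega
  | cons x t ih =>
    by_cases h : a.natAbs = t.length + 1
    · cases x with
      | some d => exact absurd (by rw [h]; exact Finset.mem_insert_self _ _) h3
      | none =>
        rcases Int.natAbs_eq a with ha | ha
        · obtain ⟨m, hm, hmax⟩ := (bounded_beadShape t).exists_max
          have : a = t.length + 1 := by omega
          exact this ▸ ⟨_, _, .pos t m hm hmax⟩
        · obtain ⟨m, hm, hmax⟩ := (bounded_beadShape t).exists_min
          have : a = -(t.length + 1) := by omega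
          exact this ▸ ⟨_, _, .neg t (m - 2) (by simpa using hm) (by simpa using hmax)⟩
    · simp only [List.length_cons] at h2
      cases x with
      | none =>
        obtain ⟨t', e, h⟩ := ih (by omega) h3
        exact ⟨_, _, .skip h⟩
      | some d =>
        obtain ⟨t', e, h⟩ := ih (by omega) (fun h' => h3 (Finset.mem_insert_of_mem h'))
        by_cases hd : d = e
        · subst hd
          obtain ⟨p, hp⟩ := (bounded_beadShape t).exists_nextMove d
          exact ⟨_, _, .collide p h hp⟩
        · exact ⟨_, _, .keep d h hd⟩

/-! ### Reverse insertion and comparison of successive moves -/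

theorem not_prevMove_of_max {s : Set ℤ} {m e : ℤ} (hmax : ∀ x ∈ s, x ≤ m) :
    ¬ PrevMove s m e := by
  rintro (⟨a, b, c, d⟩ | ⟨a, b, c, d⟩)
  · have := hmax _ b; omega
  · have := hmax _ a; omega

theorem not_prevMove_of_min {s : Set ℤ} {m e : ℤ} (hmin : ∀ x, x ∉ s → m + 2 ≤ x) :
    ¬ PrevMove s m e := by
  rintro (⟨a, b, c, d⟩ | ⟨a, b, c, d⟩)
  · have := hmin _ a; omega
  · have := hmin _ b; omega

theorem not_max_and_min {s : Set ℤ} {m : ℤ} (hmax : ∀ x ∈ s, x ≤ m)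
    (hmin : ∀ x, x ∉ s → m + 2 ≤ x) : False := by
  by_cases h : m + 1 ∈ s
  · have := hmax _ h; omega
  · have := hmin _ h; omega

/-- Reverse insertion is unique. -/
theorem MoveInsert.unique {t u t' : MoveTableau} {a b e : ℤ} (h : MoveInsert t a t' e)
    (h' : MoveInsert u b t' e) (ht : ValidMoves t) (hu : ValidMoves u) : t = u ∧ a = b := by
  induction h generalizing u b with
  | pos t m hm hmax =>
    cases h' with
    | pos => exact ⟨rfl, rfl⟩
    | neg _ _ hm' hmin => exact (not_max_and_min hmax hmin).elim
    | keep d h hd => exact absurd rfl hd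
    | collide p h hp =>
      obtain ⟨-, h2, h3⟩ := h.valid hu.1
      exact (not_prevMove_of_max hmax (h3 ▸ hp.prevMove h2)).elim
  | neg t m hm hmin =>
    cases h' with
    | neg => exact ⟨rfl, rfl⟩
    | pos _ _ hm' hmax => exact (not_max_and_min hmax hmin).elim
    | keep d h hd => exact absurd rfl hd
    | collide p h hp =>
      obtain ⟨-, h2, h3⟩ := h.valid hu.1
      exact (not_prevMove_of_min hmin (h3 ▸ hp.prevMove h2)).elim
  | skip h ih =>
    cases h' with
    | skip h' =>
      obtain ⟨rfl, rfl⟩ := ih h' ht hu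
      exact ⟨rfl, rfl⟩
  | keep d h hd ih =>
    cases h' with
    | pos => exact absurd rfl hd
    | neg => exact absurd rfl hd
    | collide p h hp => exact absurd rfl hd
    | keep _ h' _ =>
      obtain ⟨rfl, rfl⟩ := ih h' ht.1 hu.1
      exact ⟨rfl, rfl⟩
  | collide p h hp ih =>
    obtain ⟨-, h2, h3⟩ := h.valid ht.1
    cases h' with
    | pos _ _ _ hmax => exact (not_prevMove_of_max hmax (h3 ▸ hp.prevMove h2)).elim
    | neg _ _ _ hmin => exact (not_prevMove_of_min hmin (h3 ▸ hp.prevMove h2)).elim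
    | keep d h hd => exact absurd rfl hd
    | collide _ h' hp' =>
      obtain ⟨-, h4, h5⟩ := h'.valid hu.1
      have := (h3 ▸ hp.prevMove h2 : PrevMove _ _ _).unique (h5 ▸ hp'.prevMove h4)
      subst this
      obtain ⟨rfl, rfl⟩ := ih h' ht.1 hu.1
      exact ⟨rfl, rfl⟩

/-- Insertion is a function. -/
theorem MoveInsert.functional {t t' u : MoveTableau} {a e f : ℤ} (h : MoveInsert t a t' e)
    (h' : MoveInsert t a u f) : t' = u ∧ e = f := by
  generalize hb : a = b at h'
  induction h generalizing u f with
  | pos t m hm hmax =>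
    cases h' with
    | pos _ _ hm' hmax' =>
      obtain rfl : m = f := le_antisymm (hmax' _ hm) (hmax _ hm')
      exact ⟨rfl, rfl⟩
    | neg => omega
    | skip h => have := h.natAbs_le; omega
  | neg t m hm hmin =>
    cases h' with
    | pos => omega
    | neg _ _ hm' hmin' =>
      have := hmin' _ hm
      have := hmin _ hm'
      obtain rfl : m = f := by omega
      exact ⟨rfl, rfl⟩
    | skip h => have := h.natAbs_le; omega
  | skip h ih =>
    cases h' with
    | pos => have := h.natAbs_le; omega
    | neg => have := h.natAbs_le; omega
    | skip h' =>
      obtain ⟨rfl, rfl⟩ := ih hb h'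
      exact ⟨rfl, rfl⟩
  | keep d h hd ih =>
    cases h' with
    | keep _ h' hd' =>
      obtain ⟨rfl, rfl⟩ := ih hb h'
      exact ⟨rfl, rfl⟩
    | collide p h' hp => exact absurd (ih hb h').2.symm hd
  | collide p h hp ih =>
    cases h' with
    | keep _ h' hd' => exact absurd (ih hb h').2 hd'
    | collide p' h' hp' =>
      obtain ⟨rfl, -⟩ := ih hb h'
      obtain rfl := hp.unique hp'
      exact ⟨rfl, rfl⟩

/-- Undoing a collision searches for the next bead to the right of `p` or for the next gap to the
left of `p + 2`. The search fails only at the rightmost bead or the leftmost gap, which are the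
places where a new letter enters. -/
theorem Bounded.exists_prevMove {s : Set ℤ} (hs : Bounded s) {p : ℤ} :
    (∀ x ∈ s, x ≤ p) ∨ (∀ x, x ∉ s → p + 2 ≤ x) ∨ ∃ e, PrevMove s p e := by
  obtain ⟨k, h1, h2⟩ := hs
  by_cases hp : p + 1 ∈ s
  · by_cases h : ∀ x, x ∉ s → p + 2 ≤ x
    · exact Or.inr (Or.inl h)
    · push Not at h
      obtain ⟨x, hx, hxp⟩ := h
      obtain ⟨q, ⟨hq, hqs⟩, hmax⟩ := exists_greatest (P := fun x => x < p + 2 ∧ x ∉ s)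
        ⟨x, hxp, hx⟩ (p + 2) (by grind)
      refine Or.inr (Or.inr ⟨q, Or.inr ⟨hp, hqs, hq, fun y hy hyp => ?_⟩⟩)
      by_contra hys
      have := hmax y ⟨hyp, hys⟩
      omega
  · by_cases h : ∀ x ∈ s, x ≤ p
    · exact Or.inl h
    · push Not at h
      obtain ⟨x, hx, hxp⟩ := h
      obtain ⟨q, ⟨hq, hqs⟩, hmin⟩ := exists_least (P := fun x => p < x ∧ x ∈ s)
        ⟨x, hxp, hx⟩ p (by grind)
      refine Or.inr (Or.inr ⟨q - 2, Or.inl ⟨hp, by simpa using hqs, by omega, fun y hy hyp hys => ?_⟩⟩)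
      have := hmin y ⟨hy, hys⟩
      omega

/-- Reverse insertion exists. -/
theorem exists_reverse_moveInsert (t' : MoveTableau) (ht' : ValidMoves t') (e : ℤ)
    (h1 : e + 2 ∈ beadShape t') (h2 : e ∉ beadShape t') :
    ∃ t a, ValidMoves t ∧ MoveInsert t a t' e := by
  induction t' generalizing e with
  | nil => simp only [beadShape, vacuum, Set.mem_ofPred_eq] at h1 h2; omega
  | cons x t' ih => cases x with
    | none =>
      obtain ⟨t, a, ht, h⟩ := ih ht' e h1 h2
      exact ⟨none :: t, a, ht, .skip h⟩
    | some d =>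
      obtain ⟨ht', hd⟩ := ht'
      by_cases hde : d = e
      · subst hde
        -- The three alternatives are the constructors `pos`, `neg` and `collide`: either the letter
        -- entered here, or the move came from a collision.
        rcases (bounded_beadShape t').exists_prevMove (p := d) with h | h | ⟨e, h⟩
        · exact ⟨none :: t', _, ht', .pos t' d hd.1 h⟩
        · exact ⟨none :: t', _, ht', .neg t' d hd.2 h⟩
        · obtain ⟨h3, h4⟩ := h.removable hd
          obtain ⟨t, a, ht, hi⟩ := ih ht' e h3 h4
          obtain ⟨-, h5, h6⟩ := hi.valid ht
          exact ⟨some e :: t, a, ⟨ht, h5⟩, .collide d hi (PrevMove.nextMove h5 (h6 ▸ hd) (h6 ▸ h))⟩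
      · simp only [beadShape, mem_moveBead] at h1 h2
        obtain ⟨hd1, hd2⟩ := hd
        obtain ⟨t, a, ht, hi⟩ := ih ht' e (by grind) (by grind)
        obtain ⟨-, h5, h6⟩ := hi.valid ht
        refine ⟨some d :: t, a, ⟨ht, ?_⟩, .keep d hi hde⟩
        rw [h6, mem_moveBead] at hd1 hd2
        exact ⟨by grind, by grind⟩

/-- Two successive insertions: the moves increase if and only if the letters do. -/
theorem MoveInsert.lt_iff {t t' t'' : MoveTableau} {a b e f : ℤ} (h : MoveInsert t a t' e)
    (h' : MoveInsert t' b t'' f) (ht : ValidMoves t) :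
    (a < b → e < f) ∧ (b < a → f < e) := by
  induction h generalizing b t'' f with
  -- The second letter has absolute value at most `t.length`, so it is smaller than `a`; and `e` is
  -- the rightmost bead, so the next move, colliding or not, lies to its left. The case `neg` is the
  -- mirror image.
  | pos t m hm hmax =>
    cases h' with
    | keep d h hd =>
      have := h.natAbs_le
      have := hmax _ (h.valid ht).2.1.1
      omega
    | collide p h hp =>
      have := h.natAbs_le
      rcases hp with ⟨-, -, hp, -⟩ | ⟨hp, -⟩
      · omega
      · have := hmax _ hp; omega
  | neg t m hm hmin =>
    cases h' with
    | keep d h hd =>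
      have := h.natAbs_le
      have := hmin _ (h.valid ht).2.1.2
      omega
    | collide p h hp =>
      have := h.natAbs_le
      rcases hp with ⟨hp, -⟩ | ⟨-, -, hp, -⟩
      · have := hmin _ hp; omega
      · omega
  | @skip t t' a e h ih =>
    have h3 := h.valid ht
    have h4 := h.natAbs_le
    have h5 := h.length_eq
    -- After the first insertion `e + 2` is a bead and `e` is a gap. So a letter entering at the
    -- rightmost bead moves to the right of `e`, and one entering at the leftmost gap to the left of
    -- `e`.
    cases h' with
    | pos _ _ hm hmax =>
      have := hmax (e + 2) (by rw [h3.2.2]; exact Or.inl rfl)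
      omega
    | neg _ _ hm hmin =>
      have := hmin e (fun hx => by
        rw [h3.2.2] at hx
        exact (hx.resolve_left (by omega)).2 rfl)
      omega
    | skip h' => exact ih h' ht
  | @keep t t' a e d h hd ih =>
    obtain ⟨ht, hdt1, hdt2⟩ := ht
    obtain ⟨h3, ⟨h4, h4'⟩, h5⟩ := h.valid ht
    cases h' with
    | keep _ h' hd' => exact ih h' ht
    | collide p h' hp =>
      have := ih h' ht
      have hde2 : d ≠ e + 2 := by rintro rfl; exact h4' hdt1
      have hed2 : e ≠ d + 2 := by rintro rfl; exact hdt2 h4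
      simp only [h5, NextMove, mem_moveBead] at hp
      -- A search to the left starting beyond `e` is stopped by the bead that has arrived at `e +
      -- 2`, one to the right by the gap left at `e`. Distances 1 and 2 between `d` and `e` in the
      -- critical direction are excluded by the direction test and by movability.
      rcases hp with ⟨h6, h7, h8, h9⟩ | ⟨h6, h7, h8, h9⟩
      · refine ⟨fun hab => ?_, fun hab => by omega⟩
        by_contra hlt
        have h10 : d ≠ e + 1 := by rintro rfl; exact h6 (Or.inl (by ring))
        exact h9 (e + 2) (by omega) (by omega) (Or.inl rfl)
      · refine ⟨fun hab => by omega, fun hab => ?_⟩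
        by_contra hlt
        have h10 : e ≠ d + 1 := by rintro rfl; exact (h6.resolve_left (by omega)).2 rfl
        have := h9 e (by omega) (by omega)
        exact (this.resolve_left (by omega)).2 rfl
  | @collide t t' a e p h hp ih =>
    obtain ⟨ht, hdt1, hdt2⟩ := ht
    obtain ⟨h3, h4, h5⟩ := h.valid ht
    -- The first collision is read backwards, on the shape on which the second letter acts.
    have hprev : PrevMove (beadShape t') p e := h5 ▸ hp.prevMove h4
    cases h' with
    | keep _ h' hd' =>
      have h6 := ih h' ht
      obtain ⟨-, ⟨h7, h7'⟩, -⟩ := h'.valid h3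
      rcases hp with ⟨-, -, hp, -⟩ | ⟨-, -, hp, -⟩
      · refine ⟨by omega, fun hab => ?_⟩
        by_contra hlt
        rcases hprev with ⟨a1, a2, a3, a4⟩ | ⟨a1, a2, a3, a4⟩
        · exact a4 f (by omega) (by omega) h7
        · omega
      · refine ⟨fun hab => ?_, by omega⟩
        by_contra hlt
        rcases hprev with ⟨a1, a2, a3, a4⟩ | ⟨a1, a2, a3, a4⟩
        · have : e + 2 = p + 1 := by omega
          exact a1 (this ▸ a2)
        · exact h7' (a4 _ (by omega) (by omega))
    | collide p' h' hp' =>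
      have h6 := ih h' ht
      -- The inverse of the first collision and the second collision both test `p + 1` on the same
      -- shape, so the two collisions go in the same direction.
      rcases hprev with ⟨a1, a2, a3, a4⟩ | ⟨a1, a2, a3, a4⟩
      · rcases hp' with ⟨b1, b2, b3, b4⟩ | ⟨b1, b2, b3, b4⟩
        · have : e ≠ p - 1 := by rintro rfl; exact a1 (by convert a2 using 1; ring)
          rcases hp with ⟨-, -, hp, -⟩ | ⟨-, -, hp, -⟩ <;> omega
        · exact absurd b1 a1
      · rcases hp' with ⟨b1, b2, b3, b4⟩ | ⟨b1, b2, b3, b4⟩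
        · exact absurd a1 b1
        · have : e ≠ p + 1 := by rintro rfl; exact a2 a1
          rcases hp with ⟨-, -, hp, -⟩ | ⟨-, -, hp, -⟩ <;> omega

theorem moveBead_injective {s s' : Set ℤ} {e : ℤ} (h : Movable s e) (h' : Movable s' e)
    (heq : moveBead s e = moveBead s' e) : s = s' := by
  obtain ⟨h1, h2⟩ := h
  obtain ⟨h3, h4⟩ := h'
  ext x
  have := Set.ext_iff.1 heq x
  simp only [mem_moveBead] at this
  by_cases hx : x = e
  · subst hx; simp [h1, h3]
  · by_cases hx' : x = e + 2
    · subst hx'; simp [h2, h4]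
    · simpa [hx, hx'] using this

/-! ### The Robinson–Schensted correspondence in terms of bead moves -/

/-- The insertion of the word `w` (last letter first) yields `t`, with the shapes growing by the
moves `q` (last move first). -/
inductive RobinsonSchensted (n : ℕ) : List ℤ → MoveTableau → List ℤ → Prop
  | nil : RobinsonSchensted n [] (List.replicate n none) []
  | cons {w : List ℤ} {t t' : MoveTableau} {q : List ℤ} {a e : ℤ}
      (h : RobinsonSchensted n w t q) (hi : MoveInsert t a t' e) :
      RobinsonSchensted n (a :: w) t' (e :: q)

theorem beadShape_replicate (n : ℕ) : beadShape (List.replicate n none) = vacuum := by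
  induction n with
  | zero => rfl
  | succ n ih => exact ih

theorem validMoves_replicate (n : ℕ) : ValidMoves (List.replicate n none) := by
  induction n with
  | zero => trivial
  | succ n ih => exact ih

theorem labelSet_replicate (n : ℕ) : labelSet (List.replicate n none) = ∅ := by
  induction n with
  | zero => rfl
  | succ n ih => exact ih

theorem eq_replicate_of_labelSet {t : MoveTableau} (h : labelSet t = ∅) :
    t = List.replicate t.length none := by
  induction t with
  | nil => rfl
  | cons x t ih => cases x with
    | none => rw [List.length_cons, List.replicate_succ, ← ih h]
    | some d => exact absurd h (Finset.insert_ne_empty _ _)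

namespace RobinsonSchensted

variable {n : ℕ} {w : List ℤ} {t : MoveTableau} {q : List ℤ}

theorem length_tableau (h : RobinsonSchensted n w t q) : t.length = n := by
  induction h with
  | nil => simp
  | cons h hi ih => rw [hi.length_eq, ih]

theorem length_moves (h : RobinsonSchensted n w t q) : q.length = w.length := by
  induction h with
  | nil => rfl
  | cons h hi ih => simp [ih]

theorem valid (h : RobinsonSchensted n w t q) :
    ValidMoves t ∧ ValidMoves (q.map some) ∧ beadShape t = beadShape (q.map some) := by
  induction h with
  | nil => exact ⟨validMoves_replicate n, trivial, beadShape_replicate n⟩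
  | cons h hi ih =>
    obtain ⟨h1, h2, h3⟩ := ih
    obtain ⟨h4, h5, h6⟩ := hi.valid h1
    exact ⟨h4, ⟨h2, h3 ▸ h5⟩, by rw [h6, h3]; rfl⟩

theorem letters (h : RobinsonSchensted n w t q) :
    (∀ a ∈ w, 1 ≤ a.natAbs ∧ a.natAbs ≤ n) ∧ (w.map Int.natAbs).Nodup ∧
      labelSet t = (w.map Int.natAbs).toFinset := by
  induction h with
  | nil => simp [labelSet_replicate]
  | cons h hi ih =>
    obtain ⟨h1, h2, h3⟩ := ih
    obtain ⟨h4, h5⟩ := hi.labelSet_eq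
    have h6 := hi.natAbs_le
    rw [h.length_tableau] at h6
    refine ⟨List.forall_mem_cons.2 ⟨h6, h1⟩, ?_, ?_⟩
    · rw [List.map_cons, List.nodup_cons]
      exact ⟨fun hm => h4 (h3 ▸ List.mem_toFinset.2 hm), h2⟩
    · rw [h5, h3, List.map_cons, List.toFinset_cons]

theorem exists_of_word (n : ℕ) (w : List ℤ) (h1 : ∀ a ∈ w, 1 ≤ a.natAbs ∧ a.natAbs ≤ n)
    (h2 : (w.map Int.natAbs).Nodup) : ∃ t q, RobinsonSchensted n w t q := by
  induction w with
  | nil => exact ⟨_, _, .nil⟩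
  | cons a w ih =>
    rw [List.map_cons, List.nodup_cons] at h2
    rw [List.forall_mem_cons] at h1
    obtain ⟨t, q, h⟩ := ih h1.2 h2.2
    obtain ⟨t', e, hi⟩ := exists_moveInsert t a h1.1.1 (by rw [h.length_tableau]; exact h1.1.2)
      (by rw [h.letters.2.2]; simpa using h2.1)
    exact ⟨_, _, .cons h hi⟩

/-- The recording moves are undone from the last one on. The hypothesis on the cardinality ensures
that the insertion tableau is empty once they are used up. -/
theorem exists_of_tableaux (n : ℕ) (q : List ℤ) (t : MoveTableau) (hn : t.length = n)
    (ht : ValidMoves t) (hq : ValidMoves (q.map some)) (hs : beadShape t = beadShape (q.map some))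
    (hc : (labelSet t).card = q.length) : ∃ w, RobinsonSchensted n w t q := by
  induction q generalizing t with
  | nil =>
    have := eq_replicate_of_labelSet (Finset.card_eq_zero.1 hc)
    rw [hn] at this
    exact ⟨[], this ▸ .nil⟩
  | cons e q ih =>
    obtain ⟨hq, he⟩ := hq
    obtain ⟨u, a, hu, hi⟩ := exists_reverse_moveInsert t ht e (by rw [hs]; exact Or.inl rfl)
      (by rw [hs]; rintro (h | h); exacts [by omega, h.2 rfl])
    obtain ⟨-, h1, h2⟩ := hi.valid hu
    obtain ⟨h3, h4⟩ := hi.labelSet_eq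
    rw [h4, Finset.card_insert_of_notMem h3, List.length_cons, add_left_inj] at hc
    obtain ⟨w, h⟩ := ih u (by rw [← hn, hi.length_eq]) hu hq
      (moveBead_injective h1 he (h2.symm.trans hs)) hc
    exact ⟨_, .cons h hi⟩

theorem unique {w' : List ℤ} (h : RobinsonSchensted n w t q) (h' : RobinsonSchensted n w' t q) :
    w = w' := by
  induction h generalizing w' with
  | nil => cases h'; rfl
  | cons h hi ih =>
    cases h' with
    | cons h' hi' =>
      obtain ⟨rfl, rfl⟩ := hi.unique hi' h.valid.1 h'.valid.1
      rw [ih h']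

theorem functional {t' : MoveTableau} {q' : List ℤ} (h : RobinsonSchensted n w t q)
    (h' : RobinsonSchensted n w t' q') : t = t' ∧ q = q' := by
  induction h generalizing t' q' with
  | nil => cases h'; exact ⟨rfl, rfl⟩
  | cons h hi ih => cases h' with
    | cons h' hi' =>
      obtain ⟨rfl, rfl⟩ := ih h'
      obtain ⟨rfl, rfl⟩ := hi.functional hi'
      exact ⟨rfl, rfl⟩

/-- The moves increase exactly where the letters do. -/
theorem getElem_lt_iff (h : RobinsonSchensted n w t q) (i : ℕ) (hi : i + 1 < w.length)
    (hi' : i + 1 < q.length) : w[i + 1] < w[i] ↔ q[i + 1] < q[i] := by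
  induction h generalizing i with
  | nil => simp at hi
  | @cons w t t' q a e h hins ih => cases i with
    | succ i => simpa using ih i (by simpa using hi) (by simpa using hi')
    | zero => cases h with
      | nil => simp at hi
      | @cons w u t q a' e' h0 hins0 =>
        have h1 := hins0.lt_iff hins h0.valid.1
        have h2 := hins.labelSet_eq.1
        rw [hins0.labelSet_eq.2] at h2
        simp only [List.getElem_cons_zero, List.getElem_cons_succ]
        refine ⟨h1.1, fun hlt => ?_⟩
        rcases lt_trichotomy a' a with h3 | h3 | h3
        · exact h3
        · exact absurd (h3 ▸ Finset.mem_insert_self _ _) h2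
        · have := h1.2 h3; omega

end RobinsonSchensted

/-- In the vacuum the rightmost bead is 0 and the leftmost gap is 1, which is reached from -1. -/
theorem MoveInsert.of_empty {t t' : MoveTableau} {a e : ℤ} (h : MoveInsert t a t' e)
    (ht : labelSet t = ∅) : 0 < a ∧ e = 0 ∨ a < 0 ∧ e = -1 := by
  induction h with
  | pos t m hm hmax =>
    rw [eq_replicate_of_labelSet (t := t) ht, beadShape_replicate] at hm hmax
    have := hmax 0 (by simp [vacuum])
    simp only [vacuum, Set.mem_ofPred_eq] at hm
    omega
  | neg t m hm hmin =>
    rw [eq_replicate_of_labelSet (t := t) ht, beadShape_replicate] at hm hmin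
    have := hmin 1 (by simp [vacuum])
    simp only [vacuum, Set.mem_ofPred_eq] at hm
    omega
  | skip h ih => exact ih ht
  | keep => exact absurd ht (Finset.insert_ne_empty _ _)
  | collide => exact absurd ht (Finset.insert_ne_empty _ _)

theorem RobinsonSchensted.first_neg_iff {n : ℕ} {w : List ℤ} {t : MoveTableau} {q : List ℤ}
    (h : RobinsonSchensted n w t q) (hw : w ≠ []) (hq : q ≠ []) :
    w.getLast hw < 0 ↔ q.getLast hq = -1 := by
  induction h with
  | nil => exact absurd rfl hw
  | cons h hi ih => cases h with
    | nil =>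
      have := hi.of_empty (labelSet_replicate n)
      simp only [List.getLast_singleton]
      omega
    | cons h0 hi0 =>
      have := ih (by simp) (by simp)
      simpa using this


/-! ### Dominoes and bead moves -/

theorem mem_cells_horizontal {r c : ℕ} {x : ℕ × ℕ} :
    x ∈ (⟨r, c, false⟩ : Domino).cells ↔ x = (r, c) ∨ x = (r, c + 1) := by
  simp [Domino.cells]

theorem mem_cells_vertical {r c : ℕ} {x : ℕ × ℕ} :
    x ∈ (⟨r, c, true⟩ : Domino).cells ↔ x = (r, c) ∨ x = (r + 1, c) := by
  simp [Domino.cells]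

/-- The smaller one of the contents of the two cells of a domino. -/
def Domino.diag (D : Domino) : ℤ := if D.vertical then D.col - D.row - 1 else D.col - D.row

@[simp] theorem diag_horizontal (r c : ℕ) : (⟨r, c, false⟩ : Domino).diag = c - r := by
  simp [Domino.diag]

@[simp] theorem diag_vertical (r c : ℕ) : (⟨r, c, true⟩ : Domino).diag = c - r - 1 := by
  simp [Domino.diag]

/-- The cells of a Young diagram. -/
def IsShape (S : Finset (ℕ × ℕ)) : Prop := IsLowerSet (S : Set (ℕ × ℕ))

/-- The domino `D` can be added to the shape `S`. -/
def Addable (S : Finset (ℕ × ℕ)) (D : Domino) : Prop :=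
  Disjoint D.cells S ∧ IsShape (S ∪ D.cells)

section Shape

variable {S : Finset (ℕ × ℕ)}

/-! ### Shapes, their rows and columns, and addable dominoes -/

theorem isShape_iff : IsShape S ↔ ∀ r c, (r, c) ∈ S → ∀ r' c', r' ≤ r → c' ≤ c → (r', c') ∈ S :=
  ⟨fun h _ _ hx _ _ hr hc => h (Prod.mk_le_mk.2 ⟨hr, hc⟩) hx,
    fun h x y hyx hx => h x.1 x.2 hx y.1 y.2 hyx.1 hyx.2⟩

theorem isShape_empty : IsShape ∅ := by simp [isShape_iff]

theorem IsShape.mem_iff_row (hS : IsShape S) (r c : ℕ) : (r, c) ∈ S ↔ c < rowLength S r := by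
  let μ : YoungDiagram := ⟨S, hS⟩
  have : μ.rowLen r = rowLength S r := μ.rowLen_eq_card
  rw [← this, ← YoungDiagram.mem_iff_lt_rowLen]
  rfl

theorem IsShape.mem_iff_col (hS : IsShape S) (r c : ℕ) : (r, c) ∈ S ↔ r < colLength S c := by
  let μ : YoungDiagram := ⟨S, hS⟩
  have : μ.colLen c = colLength S c := μ.colLen_eq_card
  rw [← this, ← YoungDiagram.mem_iff_lt_colLen]
  rfl

theorem IsShape.rowLength_eq (hS : IsShape S) {r k : ℕ} (h : ∀ c, (r, c) ∈ S ↔ c < k) :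
    rowLength S r = k := by
  have h1 := (hS.mem_iff_row r k).symm.trans (h k)
  have h2 := (hS.mem_iff_row r (rowLength S r)).symm.trans (h _)
  omega

theorem IsShape.colLength_eq (hS : IsShape S) {c k : ℕ} (h : ∀ r, (r, c) ∈ S ↔ r < k) :
    colLength S c = k := by
  have h1 := (hS.mem_iff_col k c).symm.trans (h k)
  have h2 := (hS.mem_iff_col (colLength S c) c).symm.trans (h _)
  omega

theorem IsShape.rowLength_anti (hS : IsShape S) {r r' : ℕ} (h : r ≤ r') :
    rowLength S r' ≤ rowLength S r := by
  by_contra hlt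
  push Not at hlt
  have h1 := (hS.mem_iff_row r' (rowLength S r)).2 hlt
  have h2 := (hS.mem_iff_row r _).1 (isShape_iff.1 hS _ _ h1 r _ h le_rfl)
  omega

theorem IsShape.colLength_anti (hS : IsShape S) {c c' : ℕ} (h : c ≤ c') :
    colLength S c' ≤ colLength S c := by
  by_contra hlt
  push Not at hlt
  have h1 := (hS.mem_iff_col (colLength S c) c').2 hlt
  have h2 := (hS.mem_iff_col _ c).1 (isShape_iff.1 hS _ _ h1 _ c le_rfl h)
  omega

theorem IsShape.row_col (hS : IsShape S) (r c : ℕ) :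
    c < rowLength S r ↔ r < colLength S c := by
  rw [← hS.mem_iff_row, hS.mem_iff_col]

/-- The bead configuration of a shape: there is one bead for each row. -/
def beads (S : Finset (ℕ × ℕ)) : Set ℤ := {p | ∃ r : ℕ, p = rowLength S r - r}

theorem beads_empty : beads ∅ = vacuum := by
  ext x
  simp only [beads, vacuum, rowLength, Finset.filter_empty, Finset.card_empty, Set.mem_ofPred_eq]
  refine ⟨by rintro ⟨r, rfl⟩; simp, fun h => ⟨x.natAbs, by omega⟩⟩

/-- The positions without beads correspond to the columns. -/
theorem IsShape.notMem_beads (hS : IsShape S) (p : ℤ) :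
    p ∉ beads S ↔ ∃ c : ℕ, p = c - colLength S c + 1 := by
  constructor
  · intro hp
    have hex : ∃ r : ℕ, (rowLength S r : ℤ) - r ≤ p := by
      refine ⟨rowLength S 0 + p.natAbs, ?_⟩
      have := hS.rowLength_anti (Nat.zero_le (rowLength S 0 + p.natAbs))
      omega
    classical
    obtain ⟨r, hr, hmin⟩ : ∃ r : ℕ, (rowLength S r : ℤ) - r ≤ p ∧
        ∀ r' < r, ¬ (rowLength S r' : ℤ) - r' ≤ p :=
      ⟨Nat.find hex, Nat.find_spec hex, fun r' h => Nat.find_min hex h⟩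
    have hne : (rowLength S r : ℤ) - r ≠ p := fun h => hp ⟨r, h.symm⟩
    -- Row `r` is the first one whose bead lies to the left of `p`; the column is chosen so that its
    -- length is exactly `r`.
    obtain ⟨c, hc⟩ : ∃ c : ℕ, (c : ℤ) = p + r - 1 := ⟨(p + r - 1).toNat, by omega⟩
    refine ⟨c, ?_⟩
    have h1 := hS.row_col r c
    rcases Nat.eq_zero_or_pos r with rfl | h0
    · omega
    · have h2 := hS.row_col (r - 1) c
      have h3 := hmin (r - 1) (by omega)
      omega
  · rintro ⟨c, rfl⟩ ⟨r, hr⟩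
    have := hS.row_col r c
    omega

theorem Addable.horizontal (hS : IsShape S) {r c : ℕ} (h : Addable S ⟨r, c, false⟩) :
    rowLength S r = c ∧ colLength S c = r ∧ colLength S (c + 1) = r := by
  obtain ⟨h1, h2⟩ := h
  have h3 : (r, c) ∉ S := Finset.disjoint_left.1 h1 (mem_cells_horizontal.2 (Or.inl rfl))
  have h4 : (r, c + 1) ∉ S := Finset.disjoint_left.1 h1 (mem_cells_horizontal.2 (Or.inr rfl))
  have h5 : ∀ r' c', r' ≤ r → c' ≤ c + 1 → (r', c') ∈ S ∨ r' = r ∧ (c' = c ∨ c' = c + 1) := by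
    intro r' c' hr hc
    have := isShape_iff.1 h2 r (c + 1)
      (Finset.mem_union_right _ (mem_cells_horizontal.2 (Or.inr rfl))) r' c' hr hc
    rw [Finset.mem_union, mem_cells_horizontal] at this
    simp only [Prod.mk.injEq] at this
    tauto
  have h6 := isShape_iff.1 hS
  refine ⟨hS.rowLength_eq fun x => ⟨fun hx => ?_, fun hx => ?_⟩,
    hS.colLength_eq fun x => ⟨fun hx => ?_, fun hx => ?_⟩,
    hS.colLength_eq fun x => ⟨fun hx => ?_, fun hx => ?_⟩⟩
  · by_contra hlt
    exact h3 (h6 _ _ hx _ _ le_rfl (by omega))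
  · exact (h5 r x le_rfl (by omega)).resolve_right (by omega)
  · by_contra hlt
    exact h3 (h6 _ _ hx _ _ (by omega) le_rfl)
  · exact (h5 x c (by omega) (by omega)).resolve_right (by omega)
  · by_contra hlt
    exact h4 (h6 _ _ hx _ _ (by omega) le_rfl)
  · exact (h5 x (c + 1) (by omega) (by omega)).resolve_right (by omega)

theorem Addable.vertical (hS : IsShape S) {r c : ℕ} (h : Addable S ⟨r, c, true⟩) :
    colLength S c = r ∧ rowLength S r = c ∧ rowLength S (r + 1) = c := by
  obtain ⟨h1, h2⟩ := h
  have h3 : (r, c) ∉ S := Finset.disjoint_left.1 h1 (mem_cells_vertical.2 (Or.inl rfl))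
  have h4 : (r + 1, c) ∉ S := Finset.disjoint_left.1 h1 (mem_cells_vertical.2 (Or.inr rfl))
  have h5 : ∀ r' c', r' ≤ r + 1 → c' ≤ c → (r', c') ∈ S ∨ (r' = r ∨ r' = r + 1) ∧ c' = c := by
    intro r' c' hr hc
    have := isShape_iff.1 h2 (r + 1) c
      (Finset.mem_union_right _ (mem_cells_vertical.2 (Or.inr rfl))) r' c' hr hc
    rw [Finset.mem_union, mem_cells_vertical] at this
    simp only [Prod.mk.injEq] at this
    tauto
  have h6 := isShape_iff.1 hS
  refine ⟨hS.colLength_eq fun x => ⟨fun hx => ?_, fun hx => ?_⟩,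
    hS.rowLength_eq fun x => ⟨fun hx => ?_, fun hx => ?_⟩,
    hS.rowLength_eq fun x => ⟨fun hx => ?_, fun hx => ?_⟩⟩
  · by_contra hlt
    exact h3 (h6 _ _ hx _ _ (by omega) le_rfl)
  · exact (h5 x c (by omega) le_rfl).resolve_right (by omega)
  · by_contra hlt
    exact h3 (h6 _ _ hx _ _ le_rfl (by omega))
  · exact (h5 r x (by omega) (by omega)).resolve_right (by omega)
  · by_contra hlt
    exact h4 (h6 _ _ hx _ _ le_rfl (by omega))
  · exact (h5 (r + 1) x (by omega) (by omega)).resolve_right (by omega)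

theorem addable_horizontal (hS : IsShape S) {r c : ℕ} (h1 : rowLength S r = c)
    (h2 : ∀ x < r, (x, c + 1) ∈ S) : Addable S ⟨r, c, false⟩ := by
  refine ⟨Finset.disjoint_left.2 fun x hx => ?_, isShape_iff.2 fun x y hx x' y' hx' hy' => ?_⟩
  · rw [mem_cells_horizontal] at hx
    rcases hx with rfl | rfl <;> rw [hS.mem_iff_row] <;> omega
  · simp only [Finset.mem_union, mem_cells_horizontal, Prod.mk.injEq] at hx ⊢
    rcases hx with hx | hx
    · exact Or.inl (isShape_iff.1 hS _ _ hx _ _ hx' hy')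
    · by_cases hxr : x' < r
      · exact Or.inl (isShape_iff.1 hS _ _ (h2 _ hxr) _ _ le_rfl (by omega))
      · obtain rfl : x' = r := by omega
        rw [hS.mem_iff_row]
        omega

theorem addable_vertical (hS : IsShape S) {r c : ℕ} (h1 : colLength S c = r)
    (h2 : ∀ y < c, (r + 1, y) ∈ S) : Addable S ⟨r, c, true⟩ := by
  refine ⟨Finset.disjoint_left.2 fun x hx => ?_, isShape_iff.2 fun x y hx x' y' hx' hy' => ?_⟩
  · rw [mem_cells_vertical] at hx
    rcases hx with rfl | rfl <;> rw [hS.mem_iff_col] <;> omega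
  · simp only [Finset.mem_union, mem_cells_vertical, Prod.mk.injEq] at hx ⊢
    rcases hx with hx | hx
    · exact Or.inl (isShape_iff.1 hS _ _ hx _ _ hx' hy')
    · by_cases hyc : y' < c
      · exact Or.inl (isShape_iff.1 hS _ _ (h2 _ hyc) _ _ (by omega) le_rfl)
      · obtain rfl : y' = c := by omega
        rw [hS.mem_iff_col]
        omega

/-- Adding a domino moves a bead. -/
theorem Addable.beads_union (hS : IsShape S) {D : Domino} (h : Addable S D) :
    beads (S ∪ D.cells) = moveBead (beads S) D.diag := by
  obtain ⟨r, c, v⟩ := D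
  have hS' := h.2
  cases v with
  | false =>
    obtain ⟨h1, h2, h3⟩ := h.horizontal hS
    have hr : rowLength (S ∪ (⟨r, c, false⟩ : Domino).cells) r = c + 2 :=
      hS'.rowLength_eq fun y => by
        simp only [Finset.mem_union, mem_cells_horizontal, hS.mem_iff_row, Prod.mk.injEq, true_and]
        omega
    have hx : ∀ x ≠ r, rowLength (S ∪ (⟨r, c, false⟩ : Domino).cells) x = rowLength S x :=
      fun x hx => hS'.rowLength_eq fun y => by
        simp only [Finset.mem_union, mem_cells_horizontal, hS.mem_iff_row, Prod.mk.injEq, hx,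
          false_and, or_false]
    ext p
    simp only [beads, mem_moveBead, diag_horizontal, Set.mem_ofPred_eq]
    constructor
    · rintro ⟨x, rfl⟩
      by_cases hxr : x = r
      · subst hxr; left; rw [hr]; push_cast; ring
      · refine Or.inr ⟨⟨x, by rw [hx x hxr]⟩, ?_⟩
        rw [hx x hxr]
        rcases lt_or_gt_of_ne hxr with hlt | hlt
        · have := hS.rowLength_anti hlt.le; omega
        · have := hS.rowLength_anti hlt.le; omega
    · rintro (rfl | ⟨⟨x, rfl⟩, hne⟩)
      · exact ⟨r, by rw [hr]; push_cast; ring⟩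
      · exact ⟨x, by rw [hx x (by rintro rfl; omega)]⟩
  | true =>
    obtain ⟨h1, h2, h3⟩ := h.vertical hS
    -- A vertical domino shifts the beads of rows `r` and `r + 1` by one each, from `c - r` and `c -
    -- r - 1`. As a set, this is the left bead jumping over the right one.
    have hr : ∀ x, x = r ∨ x = r + 1 →
        rowLength (S ∪ (⟨r, c, true⟩ : Domino).cells) x = c + 1 := fun x hx =>
      hS'.rowLength_eq fun y => by
        simp only [Finset.mem_union, mem_cells_vertical, hS.mem_iff_row, Prod.mk.injEq]
        rcases hx with rfl | rfl <;> omega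
    have hx : ∀ x, x ≠ r → x ≠ r + 1 →
        rowLength (S ∪ (⟨r, c, true⟩ : Domino).cells) x = rowLength S x :=
      fun x hx hx' => hS'.rowLength_eq fun y => by
        simp only [Finset.mem_union, mem_cells_vertical, hS.mem_iff_row, Prod.mk.injEq, hx, hx',
          false_and, or_false]
    ext p
    simp only [beads, mem_moveBead, diag_vertical, Set.mem_ofPred_eq]
    constructor
    · rintro ⟨x, rfl⟩
      by_cases hxr : x = r
      · subst hxr; left; rw [hr x (Or.inl rfl)]; push_cast; ring
      · by_cases hxr' : x = r + 1
        · subst hxr'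
          rw [hr _ (Or.inr rfl)]
          exact Or.inr ⟨⟨r, by rw [h2]; push_cast; ring⟩, by push_cast; omega⟩
        · refine Or.inr ⟨⟨x, by rw [hx x hxr hxr']⟩, ?_⟩
          rw [hx x hxr hxr']
          rcases lt_or_gt_of_ne hxr' with hlt | hlt
          · have := hS.rowLength_anti hlt.le; omega
          · have := hS.rowLength_anti hlt.le; omega
    · rintro (rfl | ⟨⟨x, rfl⟩, hne⟩)
      · exact ⟨r, by rw [hr r (Or.inl rfl)]; push_cast; ring⟩
      · by_cases hxr : x = r
        · subst hxr
          exact ⟨x + 1, by rw [hr _ (Or.inr rfl), h2]; push_cast; ring⟩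
        · by_cases hxr' : x = r + 1
          · subst hxr'
            exact absurd (by rw [h3]; push_cast; ring) hne
          · exact ⟨x, by rw [hx x hxr hxr']⟩

/-- The bead one step right of the moved one records the direction of the domino. -/
theorem Addable.mem_beads_iff (hS : IsShape S) {D : Domino} (h : Addable S D) :
    D.diag + 1 ∈ beads S ↔ D.vertical = true := by
  obtain ⟨r, c, v⟩ := D
  cases v with
  | false =>
    obtain ⟨h1, h2, h3⟩ := h.horizontal hS
    have : (c : ℤ) - r + 1 ∉ beads S := (hS.notMem_beads _).2 ⟨c, by rw [h2]⟩
    simpa using this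
  | true =>
    obtain ⟨h1, h2, h3⟩ := h.vertical hS
    simp only [diag_vertical, iff_true]
    exact ⟨r, by rw [h2]; ring⟩

theorem Addable.movable (hS : IsShape S) {D : Domino} (h : Addable S D) :
    Movable (beads S) D.diag := by
  obtain ⟨r, c, v⟩ := D
  cases v with
  | false =>
    obtain ⟨h1, h2, h3⟩ := h.horizontal hS
    rw [diag_horizontal]
    exact ⟨⟨r, by rw [h1]⟩, (hS.notMem_beads _).2 ⟨c + 1, by rw [h3]; push_cast; ring⟩⟩
  | true =>
    obtain ⟨h1, h2, h3⟩ := h.vertical hS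
    rw [diag_vertical]
    exact ⟨⟨r + 1, by rw [h3]; push_cast; ring⟩, (hS.notMem_beads _).2 ⟨c, by rw [h1]; ring⟩⟩

/-- An addable domino is determined by its diagonal. -/
theorem Addable.eq_of_diag (hS : IsShape S) {D D' : Domino} (h : Addable S D)
    (h' : Addable S D') (hd : D.diag = D'.diag) : D = D' := by
  have hv : D.vertical = D'.vertical := by
    have := (h.mem_beads_iff hS).symm.trans (hd ▸ h'.mem_beads_iff hS)
    exact Bool.eq_iff_iff.2 this
  obtain ⟨r, c, v⟩ := D
  obtain ⟨r', c', v'⟩ := D'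
  simp only at hv
  subst hv
  cases v with
  | false =>
    obtain ⟨h1, h2, -⟩ := h.horizontal hS
    obtain ⟨h3, h4, -⟩ := h'.horizontal hS
    simp only [diag_horizontal] at hd
    have := hS.row_col r c'
    have := hS.row_col r' c
    obtain rfl : r = r' := by omega
    obtain rfl : c = c' := by omega
    rfl
  | true =>
    obtain ⟨h1, h2, -⟩ := h.vertical hS
    obtain ⟨h3, h4, -⟩ := h'.vertical hS
    simp only [diag_vertical] at hd
    have := hS.row_col r c'
    have := hS.row_col r' c
    obtain rfl : r = r' := by omega
    obtain rfl : c = c' := by omega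
    rfl

/-- The bead at `D.diag` has just left, so the next move cannot start there. This makes the order of
consecutive dominoes with equal labels strict. -/
theorem Addable.diag_ne {D D' : Domino} (hS : IsShape S) (h : Addable S D)
    (h' : Addable (S ∪ D.cells) D') : D'.diag ≠ D.diag := by
  intro hd
  have := (h'.movable h.2).1
  rw [h.beads_union hS, hd] at this
  rcases this with h | h
  · omega
  · exact h.2 rfl

theorem Addable.union_sdiff {D : Domino} (h : Addable S D) : (S ∪ D.cells) \ S = D.cells := by
  rw [Finset.union_sdiff_left, Finset.sdiff_eq_self_of_disjoint h.1]

/-! ### The bumping rule in terms of diagonals -/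

theorem bump_union {D G : Domino} (hG : Addable S G) :
    bump S (S ∪ G.cells) D = if Disjoint D.cells G.cells then D
      else if D.cells = G.cells then
        if D.vertical then colEnd (S ∪ G.cells) (D.col + 1) else rowEnd (S ∪ G.cells) (D.row + 1)
      else if D.vertical then ⟨D.row + 1, D.col, false⟩ else ⟨D.row, D.col + 1, true⟩ := by
  rw [bump, hG.union_sdiff]

/-- Two overlapping addable dominoes of different directions. -/
theorem addable_turn_horizontal (hS : IsShape S) {r c : ℕ} (h : Addable S ⟨r, c, true⟩)
    (h' : Addable S ⟨r, c, false⟩) :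
    Addable (S ∪ (⟨r, c, false⟩ : Domino).cells) ⟨r + 1, c, false⟩ := by
  obtain ⟨h1, h2, h3⟩ := h.vertical hS
  obtain ⟨h4, h5, h6⟩ := h'.horizontal hS
  refine addable_horizontal h'.2 (h'.2.rowLength_eq fun y => ?_) fun x hx => ?_
  · simp [mem_cells_horizontal, hS.mem_iff_row, h3]
  · simp [mem_cells_horizontal, hS.mem_iff_col, h6]
    omega

theorem addable_turn_vertical (hS : IsShape S) {r c : ℕ} (h : Addable S ⟨r, c, true⟩)
    (h' : Addable S ⟨r, c, false⟩) :
    Addable (S ∪ (⟨r, c, true⟩ : Domino).cells) ⟨r, c + 1, true⟩ := by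
  obtain ⟨h1, h2, h3⟩ := h.vertical hS
  obtain ⟨h4, h5, h6⟩ := h'.horizontal hS
  refine addable_vertical h.2 (h.2.colLength_eq fun y => ?_) fun x hx => ?_
  · simp [mem_cells_vertical, hS.mem_iff_col, h6]
  · simp [mem_cells_vertical, hS.mem_iff_row, h3]
    omega

/-- The two tilings of a 2 by 2 square. -/
theorem union_turn (S : Finset (ℕ × ℕ)) (r c : ℕ) :
    S ∪ (⟨r, c, false⟩ : Domino).cells ∪ (⟨r + 1, c, false⟩ : Domino).cells =
      S ∪ (⟨r, c, true⟩ : Domino).cells ∪ (⟨r, c + 1, true⟩ : Domino).cells := by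
  ext x
  simp only [Finset.mem_union, mem_cells_horizontal, mem_cells_vertical]
  tauto

/-- Meeting dominoes of the same direction share a row or a column, whose length fixes their
position, so they are equal. Dominoes of different directions can only share the top left cell. -/
theorem Addable.overlap (hS : IsShape S) {D G : Domino} (hD : Addable S D) (hG : Addable S G)
    (hne : D ≠ G) (hdis : ¬ Disjoint D.cells G.cells) :
    ∃ r c, D = ⟨r, c, true⟩ ∧ G = ⟨r, c, false⟩ ∨ D = ⟨r, c, false⟩ ∧ G = ⟨r, c, true⟩ := by
  obtain ⟨r, c, v⟩ := D
  obtain ⟨r', c', v'⟩ := G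
  rw [Finset.not_disjoint_iff] at hdis
  obtain ⟨x, hx, hx'⟩ := hdis
  cases v <;> cases v'
  · obtain ⟨h1, h2, h3⟩ := hD.horizontal hS
    obtain ⟨h4, h5, h6⟩ := hG.horizontal hS
    rw [mem_cells_horizontal] at hx hx'
    obtain rfl : r = r' := by grind
    exact absurd (by rw [← h1, ← h4]) hne
  · obtain ⟨h1, h2, h3⟩ := hD.horizontal hS
    obtain ⟨h4, h5, h6⟩ := hG.vertical hS
    rw [mem_cells_horizontal] at hx
    rw [mem_cells_vertical] at hx'
    obtain ⟨rfl, rfl⟩ : r = r' ∧ c = c' := by grind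
    exact ⟨r, c, Or.inr ⟨rfl, rfl⟩⟩
  · obtain ⟨h1, h2, h3⟩ := hD.vertical hS
    obtain ⟨h4, h5, h6⟩ := hG.horizontal hS
    rw [mem_cells_vertical] at hx
    rw [mem_cells_horizontal] at hx'
    obtain ⟨rfl, rfl⟩ : r = r' ∧ c = c' := by grind
    exact ⟨r, c, Or.inl ⟨rfl, rfl⟩⟩
  · obtain ⟨h1, h2, h3⟩ := hD.vertical hS
    obtain ⟨h4, h5, h6⟩ := hG.vertical hS
    rw [mem_cells_vertical] at hx hx'
    obtain rfl : c = c' := by grind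
    exact absurd (by rw [← h1, ← h4]) hne

/-- The bumping rule for different diagonals: diagonals are preserved. -/
theorem bump_of_diag_ne (hS : IsShape S) {D G : Domino} (hD : Addable S D) (hG : Addable S G)
    (hne : D.diag ≠ G.diag) :
    Addable (S ∪ G.cells) (bump S (S ∪ G.cells) D) ∧
      (bump S (S ∪ G.cells) D).diag = D.diag ∧
      ∃ G', Addable (S ∪ D.cells) G' ∧ G'.diag = G.diag ∧
        S ∪ G.cells ∪ (bump S (S ∪ G.cells) D).cells = S ∪ D.cells ∪ G'.cells := by
  have hDG : D ≠ G := fun h => hne (h ▸ rfl)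
  rw [bump_union hG]
  by_cases hdis : Disjoint D.cells G.cells
  · rw [if_pos hdis]
    have hcomm : S ∪ G.cells ∪ D.cells = S ∪ D.cells ∪ G.cells := by
      rw [Finset.union_assoc, Finset.union_comm G.cells, Finset.union_assoc]
    have hshape : IsShape (S ∪ D.cells ∪ G.cells) := by
      have : S ∪ D.cells ∪ G.cells = (S ∪ D.cells) ∪ (S ∪ G.cells) := by
        ext; simp only [Finset.mem_union]; tauto
      rw [this, IsShape, Finset.coe_union]
      exact IsLowerSet.union hD.2 hG.2
    exact ⟨⟨Finset.disjoint_union_right.2 ⟨hD.1, hdis⟩, hcomm ▸ hshape⟩, rfl, G,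
      ⟨Finset.disjoint_union_right.2 ⟨hG.1, hdis.symm⟩, hshape⟩, rfl, hcomm⟩
  · rw [if_neg hdis]
    obtain ⟨r, c, ⟨rfl, rfl⟩ | ⟨rfl, rfl⟩⟩ := hD.overlap hS hG hDG hdis
    · have hc : (⟨r, c, true⟩ : Domino).cells ≠ (⟨r, c, false⟩ : Domino).cells := fun h => by
        have := h ▸ (mem_cells_vertical (r := r) (c := c)).2 (Or.inr rfl)
        rw [mem_cells_horizontal] at this
        simp at this
      rw [if_neg hc]
      -- The turned domino starts at `(r + 1, c)`, and its diagonal `c - (r + 1)` is that of the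
      -- vertical domino at `(r, c)`.
      refine ⟨addable_turn_horizontal hS hD hG, by simp; ring, ⟨r, c + 1, true⟩,
        addable_turn_vertical hS hD hG, by simp; ring, union_turn S r c⟩
    · have hc : (⟨r, c, false⟩ : Domino).cells ≠ (⟨r, c, true⟩ : Domino).cells := fun h => by
        have := h.symm ▸ (mem_cells_vertical (r := r) (c := c)).2 (Or.inr rfl)
        rw [mem_cells_horizontal] at this
        simp at this
      rw [if_neg hc]
      refine ⟨addable_turn_vertical hS hG hD, by simp; ring, ⟨r + 1, c, false⟩,
        addable_turn_horizontal hS hG hD, by simp; ring, (union_turn S r c).symm⟩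

/-- The bumping rule for equal dominoes. -/
theorem bump_self (hS : IsShape S) {D : Domino} (hD : Addable S D) {p : ℤ}
    (hp : NextMove (beads S) D.diag p) :
    Addable (S ∪ D.cells) (bump S (S ∪ D.cells) D) ∧ (bump S (S ∪ D.cells) D).diag = p := by
  have hdis : ¬ Disjoint D.cells D.cells := by
    rw [disjoint_self]
    exact Finset.ne_empty_of_mem (a := (D.row, D.col)) (by simp [Domino.cells])
  rw [bump_union hD, if_neg hdis, if_pos rfl]
  have hv := hD.mem_beads_iff hS
  obtain ⟨r, c, v⟩ := D
  have hS' := hD.2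
  have hS'' := isShape_iff.1 hS
  cases v with
  | false =>
    obtain ⟨h1, h2, h3⟩ := hD.horizontal hS
    have hlen : rowLength (S ∪ (⟨r, c, false⟩ : Domino).cells) (r + 1) = rowLength S (r + 1) :=
      hS'.rowLength_eq fun y => by
        simp [mem_cells_horizontal, hS.mem_iff_row]
    have hle := hS.rowLength_anti (Nat.le_add_right r 1)
    simp only [rowEnd, Bool.false_eq_true, if_false, diag_horizontal]
    refine ⟨addable_horizontal hS' rfl fun x hx => ?_, ?_⟩
    · rw [hlen]
      by_cases hxr : x = r
      · subst hxr
        simp [mem_cells_horizontal, hS.mem_iff_row]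
        omega
      · refine Finset.mem_union_left _ ((hS.mem_iff_row _ _).2 ?_)
        have := (hS.row_col x (c + 1)).2 (by omega)
        omega
    · rw [hlen]
      -- Beads move strictly left from row to row, so the next bead to the left belongs to row `r +
      -- 1`.
      refine (hp.unique (Or.inl ⟨by simpa using hv, ⟨r + 1, rfl⟩, ?_, ?_⟩)).symm
      · simp only [diag_horizontal]; push_cast; omega
      · rintro x hx hx' ⟨y, rfl⟩
        simp only [diag_horizontal] at hx'
        rcases Nat.lt_or_ge r y with hy | hy
        · have := hS.rowLength_anti (show r + 1 ≤ y from hy)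
          push_cast at hx
          omega
        · have := hS.rowLength_anti hy
          omega
  | true =>
    obtain ⟨h1, h2, h3⟩ := hD.vertical hS
    have hlen : colLength (S ∪ (⟨r, c, true⟩ : Domino).cells) (c + 1) = colLength S (c + 1) :=
      hS'.colLength_eq fun y => by
        simp [mem_cells_vertical, hS.mem_iff_col]
    have hle := hS.colLength_anti (Nat.le_add_right c 1)
    simp only [colEnd, if_true, diag_vertical]
    refine ⟨addable_vertical hS' rfl fun x hx => ?_, ?_⟩
    · rw [hlen]
      by_cases hxr : x = c
      · subst hxr
        simp [mem_cells_vertical, hS.mem_iff_col]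
        omega
      · refine Finset.mem_union_left _ ((hS.mem_iff_col _ _).2 ?_)
        have := (hS.row_col (r + 1) x).1 (by omega)
        omega
    · rw [hlen]
      -- Likewise the gaps move strictly right from column to column, and the next gap belongs to
      -- column `c + 1`.
      refine NextMove.unique (Or.inr ⟨by simpa using hv,
        (hS.notMem_beads _).2 ⟨c + 1, by push_cast; ring⟩, ?_, ?_⟩) hp
      · simp only [diag_vertical]; push_cast; omega
      · intro x hx hx'
        by_contra hxs
        obtain ⟨y, rfl⟩ := (hS.notMem_beads _).1 hxs
        simp only [diag_vertical] at hx
        rcases Nat.lt_or_ge c y with hy | hy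
        · have := hS.colLength_anti (show c + 1 ≤ y from hy)
          push_cast at hx'
          omega
        · have := hS.colLength_anti hy
          omega

theorem addable_rowEnd_zero (hS : IsShape S) {m : ℤ} (hm : m ∈ beads S)
    (hmax : ∀ x ∈ beads S, x ≤ m) : Addable S (rowEnd S 0) ∧ (rowEnd S 0).diag = m := by
  refine ⟨addable_horizontal hS rfl (by simp), ?_⟩
  have h1 := hmax _ ⟨0, rfl⟩
  obtain ⟨r, rfl⟩ := hm
  have := hS.rowLength_anti (Nat.zero_le r)
  simp only [rowEnd, diag_horizontal]
  omega

theorem addable_colEnd_zero (hS : IsShape S) {m : ℤ} (hm : m + 2 ∉ beads S)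
    (hmin : ∀ x, x ∉ beads S → m + 2 ≤ x) : Addable S (colEnd S 0) ∧ (colEnd S 0).diag = m := by
  refine ⟨addable_vertical hS rfl (by simp), ?_⟩
  have h1 := hmin _ ((hS.notMem_beads _).2 ⟨0, rfl⟩)
  obtain ⟨c, hc⟩ := (hS.notMem_beads _).1 hm
  have := hS.colLength_anti (Nat.zero_le c)
  simp only [colEnd, diag_vertical]
  omega

end Shape


/-! ### Insertion of letters into chains of shapes -/

/-- A tableau as a list of its dominoes: the entry at the head belongs to the largest label, which
is the length of the list. -/
abbrev DominoList := List (Option Domino)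

namespace DominoList

/-- The cells of a tableau. -/
def cells : DominoList → Finset (ℕ × ℕ)
  | [] => ∅
  | none :: X => cells X
  | some D :: X => cells X ∪ D.cells

/-- The labelled dominoes of a tableau. -/
def filling : DominoList → Filling
  | [] => ∅
  | none :: X => filling X
  | some D :: X => insert (D, X.length + 1) (filling X)

/-- The dominoes can be added one after the other. -/
def IsGrowth : DominoList → Prop
  | [] => True
  | none :: X => IsGrowth X
  | some D :: X => IsGrowth X ∧ Addable (cells X) D

/-- The bead moves of the dominoes. -/
def moves (X : DominoList) : MoveTableau := X.map (Option.map Domino.diag)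

theorem IsGrowth.isShape {X : DominoList} (h : IsGrowth X) : IsShape (cells X) := by
  induction X with
  | nil => exact isShape_empty
  | cons x X ih => cases x with
    | none => exact ih h
    | some D => exact h.2.2

theorem IsGrowth.beads_cells {X : DominoList} (h : IsGrowth X) :
    beads (cells X) = beadShape (moves X) := by
  induction X with
  | nil => exact beads_empty
  | cons x X ih => cases x with
    | none => exact ih h
    | some D =>
      change beads (cells X ∪ D.cells) = moveBead (beadShape (moves X)) D.diag
      rw [h.2.beads_union h.1.isShape, ih h.1]

theorem IsGrowth.validMoves {X : DominoList} (h : IsGrowth X) : ValidMoves (moves X) := by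
  induction X with
  | nil => trivial
  | cons x X ih => cases x with
    | none => exact ih h
    | some D => exact ⟨ih h.1, h.1.beads_cells ▸ h.2.movable h.1.isShape⟩

theorem IsGrowth.eq_of_moves {X Y : DominoList} (hX : IsGrowth X) (hY : IsGrowth Y)
    (h : moves X = moves Y) : X = Y := by
  induction X generalizing Y with
  | nil => exact (List.map_eq_nil_iff.1 h.symm).symm
  | cons x X ih =>
    cases Y with
    | nil => simp [moves] at h
    | cons y Y =>
      simp only [moves, List.map_cons, List.cons.injEq] at h
      cases x with
      | none => cases y with
        | none => rw [ih (Y := Y) hX hY h.2]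
        | some E => simp at h
      | some D => cases y with
        | none => simp at h
        | some E =>
          obtain rfl := ih hX.1 hY.1 h.2
          rw [hX.2.eq_of_diag hX.1.isShape hY.2 (by simpa using h.1)]

theorem label_mem {X : DominoList} {p : Domino × ℕ} (h : p ∈ filling X) :
    1 ≤ p.2 ∧ p.2 ≤ X.length := by
  induction X with
  | nil => simp [filling] at h
  | cons x X ih => cases x with
    | none => have := ih h; simp only [List.length_cons]; omega
    | some D =>
      simp only [filling, Finset.mem_insert] at h
      rcases h with rfl | h
      · simp
      · have := ih h; simp only [List.length_cons]; omega

theorem cells_filling (X : DominoList) : (filling X).cells = cells X := by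
  induction X with
  | nil => rfl
  | cons x X ih => cases x with
    | none => exact ih
    | some D =>
      rw [filling, Filling.cells, Finset.biUnion_insert, Finset.union_comm]
      exact congrArg (· ∪ D.cells) ih

/-- Equal lengths are required because entries `none` at the head leave no trace in the filling. -/
theorem filling_injective {X Y : DominoList} (hlen : X.length = Y.length)
    (h : filling X = filling Y) : X = Y := by
  induction X generalizing Y with
  | nil => exact (List.length_eq_zero_iff.1 hlen.symm).symm
  | cons x X ih => cases Y with
    | nil => simp at hlen
    | cons y Y =>
      simp only [List.length_cons, add_left_inj] at hlen
      have hX : ∀ D, (D, X.length + 1) ∉ filling X := fun D hD => by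
        have := label_mem hD; simp only at this; omega
      have hY : ∀ D, (D, X.length + 1) ∉ filling Y := fun D hD => by
        have := label_mem hD; simp only at this; omega
      cases x with
      | none => cases y with
        | none => rw [ih hlen h]
        | some E => exact absurd (h ▸ by rw [hlen]; exact Finset.mem_insert_self _ _) (hX E)
      | some D => cases y with
        | none => exact absurd (h ▸ Finset.mem_insert_self _ _) (hY D)
        | some E =>
          simp only [filling, hlen] at h hX hY
          have hD : (D, Y.length + 1) ∈ insert (E, Y.length + 1) (filling Y) :=
            h ▸ Finset.mem_insert_self _ _
          have hDE : D = E := by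
            rcases Finset.mem_insert.1 hD with hD | hD
            · exact congrArg Prod.fst hD
            · exact absurd hD (hY D)
          subst hDE
          have := congrArg (fun S => S.erase (D, Y.length + 1)) h
          simp only [Finset.erase_insert (hX D), Finset.erase_insert (hY D)] at this
          rw [ih hlen this]

/-- The insertion of a letter into the part `X` of `T` with labels at most the length of `X`. -/
theorem exists_insert (T : Filling) (X : DominoList) (hX : IsGrowth X)
    (hT : ∀ p, p ∈ T ∧ p.2 ≤ X.length ↔ p ∈ filling X) {t' : MoveTableau} {a e : ℤ}
    (h : MoveInsert (moves X) a t' e) :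
    ∃ X', IsGrowth X' ∧ moves X' = t' ∧
      (∃ G, Addable (cells X) G ∧ G.diag = e ∧ cells X' = cells X ∪ G.cells) ∧
      (List.range' (a.natAbs + 1) (X.length - a.natAbs)).foldl (transfer T)
        (insert (if 0 < a then rowEnd (Filling.cells (T.filter fun p => p.2 < a.natAbs)) 0
            else colEnd (Filling.cells (T.filter fun p => p.2 < a.natAbs)) 0, a.natAbs)
          (T.filter fun p => p.2 < a.natAbs)) = filling X' := by
  induction X generalizing t' a e with
  | nil => cases h
  | cons x X ih =>
    have hT' : ∀ p, p ∈ T ∧ p.2 ≤ X.length ↔ p ∈ filling X := by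
      intro p
      have h1 := hT p
      refine ⟨fun hp => ?_, fun hp => ?_⟩
      · have h2 := h1.1 ⟨hp.1, by simp only [List.length_cons]; omega⟩
        cases x with
        | none => exact h2
        | some D =>
          rcases Finset.mem_insert.1 h2 with rfl | h2
          · have := hp.2; simp only at this; omega
          · exact h2
      · have h3 := (label_mem hp).2
        refine ⟨(h1.2 ?_).1, h3⟩
        cases x with
        | none => exact hp
        | some D => exact Finset.mem_insert_of_mem hp
    have hlt : (T.filter fun p => p.2 < X.length + 1) = filling X := by
      ext p
      rw [Finset.mem_filter, ← hT', Nat.lt_succ_iff]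
    have hlen : (moves X).length = X.length := by simp [moves]
    -- Compared with the fold for `X`, there is one more transfer, that of the label `X.length + 1`.
    -- It does nothing if the label is absent (`hnone`), and adds the bumped domino otherwise
    -- (`hsome`).
    have hrange : ∀ k ≤ X.length, List.range' (k + 1) ((x :: X).length - k) =
        List.range' (k + 1) (X.length - k) ++ [X.length + 1] := by
      intro k hk
      rw [List.length_cons, Nat.succ_sub hk, List.range'_1_concat]
      congr 2
      omega
    have hnone : x = none → ∀ U, transfer T U (X.length + 1) = U := by
      rintro rfl U
      have : (T.filter fun p => p.2 = X.length + 1) = ∅ := by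
        ext p
        simp only [Finset.mem_filter, Finset.notMem_empty, iff_false, not_and]
        intro hp hp2
        have h1 := (hT p).1 ⟨hp, by simp [hp2]⟩
        have := label_mem (X := X) h1
        omega
      rw [transfer, this, Finset.image_empty, Finset.union_empty]
    have hsome : ∀ D, x = some D → ∀ X' : DominoList, transfer T (filling X') (X.length + 1) =
        insert (bump (cells X) (cells X') D, X.length + 1) (filling X') := by
      rintro D rfl X'
      have : (T.filter fun p => p.2 = X.length + 1) = {(D, X.length + 1)} := by
        ext p
        simp only [Finset.mem_filter, Finset.mem_singleton]
        constructor
        · rintro ⟨hp, hp2⟩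
          have h1 := (hT p).1 ⟨hp, by simp [hp2]⟩
          rcases Finset.mem_insert.1 h1 with h1 | h1
          · exact h1
          · have := label_mem (X := X) h1
            omega
        · rintro rfl
          exact ⟨((hT _).2 (Finset.mem_insert_self _ _)).1, rfl⟩
      rw [transfer, this, Finset.image_singleton, hlt, cells_filling, cells_filling,
        Finset.union_comm]
      rfl
    cases x with
    | none =>
      have h : MoveInsert (none :: moves X) a t' e := h
      have hX : IsGrowth X := hX
      cases h with
      | pos _ m hm hmax =>
        rw [← hX.beads_cells] at hm hmax
        obtain ⟨h1, h2⟩ := addable_rowEnd_zero hX.isShape hm hmax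
        refine ⟨some (rowEnd (cells X) 0) :: X, ⟨hX, h1⟩, by simp [moves, h2], ⟨_, h1, h2, rfl⟩, ?_⟩
        have h3 : ((((moves X).length : ℤ)) + 1).natAbs = X.length + 1 := by omega
        rw [h3, if_pos (by omega), hlt, cells_filling, List.length_cons, Nat.sub_self]
        rfl
      | neg _ m hm hmin =>
        rw [← hX.beads_cells] at hm hmin
        obtain ⟨h1, h2⟩ := addable_colEnd_zero hX.isShape hm hmin
        refine ⟨some (colEnd (cells X) 0) :: X, ⟨hX, h1⟩, by simp [moves, h2], ⟨_, h1, h2, rfl⟩, ?_⟩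
        have h3 : (-(((moves X).length : ℤ) + 1)).natAbs = X.length + 1 := by omega
        rw [h3, if_neg (by omega), hlt, cells_filling, List.length_cons, Nat.sub_self]
        rfl
      | @skip _ u _ _ h =>
        obtain ⟨X', h1, h2, h3, h4⟩ := ih hX hT' h
        refine ⟨none :: X', h1, by rw [← h2]; rfl, h3, ?_⟩
        rw [hrange _ (hlen ▸ h.natAbs_le.2), List.foldl_append, h4, List.foldl_cons, List.foldl_nil,
          hnone rfl]
        rfl
    | some D =>
      have h : MoveInsert (some D.diag :: moves X) a t' e := h
      obtain ⟨hX, hD⟩ := hX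
      cases h with
      | @keep _ u _ _ _ h hd =>
        obtain ⟨X', h1, h2, ⟨G, hG, rfl, hc⟩, h4⟩ := ih hX hT' h
        obtain ⟨h5, h6, G', h7, h8, h9⟩ := bump_of_diag_ne hX.isShape hD hG hd
        have hlen' : X'.length = X.length := by
          have := h.length_eq
          rw [← h2] at this
          simpa [moves] using this
        refine ⟨some (bump (cells X) (cells X') D) :: X', ⟨h1, hc ▸ h5⟩, ?_, ⟨G', h7, h8, ?_⟩, ?_⟩
        · rw [← h2, hc, ← h6]; rfl
        · simp only [cells, hc, h9]
        · rw [hrange _ (hlen ▸ h.natAbs_le.2), List.foldl_append, h4, List.foldl_cons,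
            List.foldl_nil, hsome D rfl, filling, hlen']
      | @collide _ u _ _ _ hi hp =>
        obtain ⟨X', h1, h2, ⟨G, hG, hGD, hc⟩, h4⟩ := ih hX hT' hi
        obtain rfl := hG.eq_of_diag hX.isShape hD hGD
        obtain ⟨h5, h6⟩ := bump_self hX.isShape hD (hX.beads_cells ▸ hp)
        have hlen' : X'.length = X.length := by
          have := hi.length_eq
          rw [← h2] at this
          simpa [moves] using this
        refine ⟨some (bump (cells X) (cells X') G) :: X', ⟨h1, hc ▸ h5⟩, ?_,
          ⟨bump (cells X) (cells X') G, hc ▸ h5, hc ▸ h6, ?_⟩, ?_⟩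
        · rw [← h2, hc, ← h6]; rfl
        · simp only [cells, hc]
        · rw [hrange _ (hlen ▸ hi.natAbs_le.2), List.foldl_append, h4, List.foldl_cons,
            List.foldl_nil, hsome G rfl, filling, hlen']

theorem exists_insertLetter {n : ℕ} {X : DominoList} (hX : IsGrowth X) (hn : X.length = n)
    {t' : MoveTableau} {a e : ℤ} (h : MoveInsert (moves X) a t' e) :
    ∃ X', IsGrowth X' ∧ moves X' = t' ∧
      (∃ G, Addable (cells X) G ∧ G.diag = e ∧ cells X' = cells X ∪ G.cells) ∧
      insertLetter n (filling X) a = filling X' := by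
  subst hn
  exact exists_insert (filling X) X hX (fun p => ⟨And.left, fun hp => ⟨hp, (label_mem hp).2⟩⟩) h

theorem isGrowth_replicate (n : ℕ) : IsGrowth (List.replicate n none) := by
  induction n with
  | zero => trivial
  | succ n ih => exact ih

theorem cells_replicate (n : ℕ) : cells (List.replicate n none) = ∅ := by
  induction n with
  | zero => rfl
  | succ n ih => exact ih

theorem filling_replicate (n : ℕ) : filling (List.replicate n none) = ∅ := by
  induction n with
  | zero => rfl
  | succ n ih => exact ih

/-- The insertion tableau of a word, together with the chain of shapes. -/
theorem exists_insertWord {n : ℕ} {w : List ℤ} {t : MoveTableau} {q : List ℤ}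
    (h : RobinsonSchensted n w t q) :
    ∃ (X : DominoList) (Y : List Domino), IsGrowth X ∧ moves X = t ∧ X.length = n ∧
      IsGrowth (Y.map some) ∧ Y.map Domino.diag = q ∧ cells (Y.map some) = cells X ∧
      insertWord n w.reverse = filling X := by
  induction h with
  | nil =>
    refine ⟨List.replicate n none, [], isGrowth_replicate n, by simp [moves], by simp, trivial, rfl,
      ?_, ?_⟩
    · rw [cells_replicate]; rfl
    · rw [filling_replicate]; rfl
  | cons h hi ih =>
    obtain ⟨X, Y, h1, rfl, h3, h4, h5, h6, h7⟩ := ih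
    obtain ⟨X', h8, h9, ⟨G, h10, h11, h12⟩, h13⟩ := exists_insertLetter h1 h3 hi
    refine ⟨X', G :: Y, h8, h9, ?_, ⟨h4, h6 ▸ h10⟩, by simp [h5, h11], ?_, ?_⟩
    · rw [← h3, ← List.length_map (f := Option.map Domino.diag) (as := X'), ← moves, h9,
        hi.length_eq, moves, List.length_map]
    · simp only [List.map_cons, cells, h6, h12]
    · rw [insertWord, List.reverse_cons, List.foldl_append, ← insertWord, h7]
      exact h13

end DominoList


/-! ### Semistandard tableaux as sorted chains of shapes -/

/-- The dominoes of `T` tile the set `S` of cells. -/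
def TilesCells (T : Filling) (S : Finset (ℕ × ℕ)) : Prop :=
  (∀ p ∈ T, p.1.cells ⊆ S) ∧ ∀ c ∈ S, ∃! p, p ∈ T ∧ c ∈ p.1.cells

/-- The labels increase weakly along the rows and strictly down the columns. -/
structure IsOrdered (T : Filling) : Prop where
  row_le : ∀ p ∈ T, ∀ q ∈ T, p ≠ q → ∀ c ∈ p.1.cells, ∀ d ∈ q.1.cells,
    c.1 = d.1 → c.2 < d.2 → p.2 ≤ q.2
  col_lt : ∀ p ∈ T, ∀ q ∈ T, p ≠ q → ∀ c ∈ p.1.cells, ∀ d ∈ q.1.cells,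
    c.2 = d.2 → c.1 < d.1 → p.2 < q.2

/-- The order of the dominoes by labels, and from left to right for equal labels. -/
def Precedes (p q : Domino × ℕ) : Prop := p.2 < q.2 ∨ p.2 = q.2 ∧ p.1.diag < q.1.diag

theorem Precedes.trans {p q r : Domino × ℕ} (h : Precedes p q) (h' : Precedes q r) :
    Precedes p r := by
  unfold Precedes at *
  omega

theorem Precedes.irrefl (p : Domino × ℕ) : ¬ Precedes p p := by
  unfold Precedes
  omega

/-- A list of labelled dominoes (last one first) that can be added one after the other, in the order
of `Precedes`. -/
structure IsSortedGrowth (L : List (Domino × ℕ)) : Prop where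
  growth : DominoList.IsGrowth (L.map fun p => some p.1)
  sorted : L.Pairwise fun p q => Precedes q p

/-- The cells of a list of labelled dominoes. -/
def listCells (L : List (Domino × ℕ)) : Finset (ℕ × ℕ) :=
  DominoList.cells (L.map fun p => some p.1)

theorem Domino.diag_le {D : Domino} {x : ℕ × ℕ} (h : x ∈ D.cells) :
    D.diag ≤ x.2 - x.1 ∧ (x.2 : ℤ) - x.1 ≤ D.diag + 1 := by
  obtain ⟨r, c, v⟩ := D
  cases v with
  | false =>
    rw [mem_cells_horizontal] at h
    rw [diag_horizontal]
    rcases h with rfl | rfl <;> constructor <;> push_cast <;> omega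
  | true =>
    rw [mem_cells_vertical] at h
    rw [diag_vertical]
    rcases h with rfl | rfl <;> constructor <;> push_cast <;> omega

theorem Domino.cells_nonempty (D : Domino) : D.cells.Nonempty := ⟨(D.row, D.col), by simp [cells]⟩

theorem TilesCells.erase {T : Filling} {S : Finset (ℕ × ℕ)} (h : TilesCells T S)
    {p : Domino × ℕ} (hp : p ∈ T) : TilesCells (T.erase p) (S \ p.1.cells) := by
  refine ⟨fun q hq x hx => ?_, fun c hc => ?_⟩
  · rw [Finset.mem_erase] at hq
    have hxS := h.1 q hq.2 hx
    refine Finset.mem_sdiff.2 ⟨hxS, fun hxp => hq.1 ?_⟩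
    exact (h.2 x hxS).unique ⟨hq.2, hx⟩ ⟨hp, hxp⟩
  · rw [Finset.mem_sdiff] at hc
    obtain ⟨q, ⟨hq, hqc⟩, huniq⟩ := h.2 c hc.1
    refine ⟨q, ⟨Finset.mem_erase.2 ⟨fun h => hc.2 (h ▸ hqc), hq⟩, hqc⟩, ?_⟩
    rintro q' ⟨hq', hqc'⟩
    exact huniq q' ⟨Finset.mem_of_mem_erase hq', hqc'⟩

theorem IsOrdered.mono {T U : Filling} (h : IsOrdered T) (hU : U ⊆ T) : IsOrdered U :=
  ⟨fun p hp q hq => h.row_le p (hU hp) q (hU hq), fun p hp q hq => h.col_lt p (hU hp) q (hU hq)⟩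

/-- The last domino of a tableau can be removed. -/
theorem IsOrdered.isShape_sdiff {T : Filling} {S : Finset (ℕ × ℕ)} (hT : IsOrdered T)
    (hS : IsShape S) (h : TilesCells T S) {p : Domino × ℕ} (hp : p ∈ T)
    (hmax : ∀ q ∈ T, q.2 < p.2 ∨ q.2 = p.2 ∧ q.1.diag ≤ p.1.diag) : IsShape (S \ p.1.cells) := by
  have hS' := isShape_iff.1 hS
  have hright : ∀ r c, (r, c) ∈ p.1.cells → (r, c + 1) ∈ S → (r, c + 1) ∈ p.1.cells := by
    intro r c hc hcS
    obtain ⟨q, ⟨hq, hqc⟩, huniq⟩ := h.2 _ hcS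
    by_cases hqp : q = p
    · exact hqp ▸ hqc
    exfalso
    have h1 := hT.row_le p hp q hq (Ne.symm hqp) _ hc _ hqc rfl (Nat.lt_succ_self c)
    have h2 := hmax q hq
    have h3 := (Domino.diag_le hc).1
    have h4 := (Domino.diag_le hqc).2
    simp only at h3 h4
    push_cast at h4
    -- The labels of `p` and `q` are equal, so maximality bounds the diagonal of `q` by that of `p`;
    -- the contents of the two adjacent cells then force both diagonals to be `c - r`. A horizontal
    -- `p` would contain `(r, c + 1)`, and a horizontal `q` would contain `(r, c)`.
    have h5 : p.1.diag = c - r := by omega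
    have h6 : q.1.diag = c - r := by omega
    have hpc : (r, c) ∉ q.1.cells := fun h' =>
      hqp ((h.2 _ (h.1 p hp hc)).unique ⟨hq, h'⟩ ⟨hp, hc⟩)
    have hpc' : (r, c + 1) ∉ p.1.cells := fun h' => hqp (huniq p ⟨hp, h'⟩).symm
    obtain ⟨⟨a, b, v⟩, k⟩ := p
    obtain ⟨⟨a', b', v'⟩, k'⟩ := q
    cases v with
    | false =>
      simp only [mem_cells_horizontal, Prod.mk.injEq, diag_horizontal] at hc hpc' h5
      omega
    | true =>
      cases v' with
      | false =>
        simp only [mem_cells_horizontal, Prod.mk.injEq, diag_horizontal] at hqc hpc h6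
        omega
      | true =>
        simp only [mem_cells_vertical, Prod.mk.injEq, diag_vertical] at hc hqc h5 h6
        -- Both dominoes are vertical and `q` sits one row lower than `p`. The domino `s` right of
        -- the top cell of `p` and above `q` separates their labels: weakly from `p`, strictly from
        -- `q`.
        obtain rfl : r = a + 1 := by omega
        obtain ⟨s, ⟨hs, hsc⟩, -⟩ := h.2 (a, c + 1) (hS' _ _ hcS _ _ (by omega) le_rfl)
        have h7 := hT.row_le _ hp s hs (by rintro rfl; simp [mem_cells_vertical] at hsc; omega)
          (a, c) (by simp [mem_cells_vertical]; omega) _ hsc rfl (by simp)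
        have h8 := hT.col_lt s hs _ hq (by rintro rfl; simp [mem_cells_vertical] at hsc; omega)
          _ hsc (a + 1, c + 1) (by simp [mem_cells_vertical]; omega) rfl (by simp)
        simp only at h7 h8 h2
        omega
  have hdown : ∀ r c, (r, c) ∈ p.1.cells → (r + 1, c) ∈ S → (r + 1, c) ∈ p.1.cells := by
    intro r c hc hcS
    obtain ⟨q, ⟨hq, hqc⟩, -⟩ := h.2 _ hcS
    by_cases hqp : q = p
    · exact hqp ▸ hqc
    have h1 := hT.col_lt p hp q hq (Ne.symm hqp) _ hc _ hqc rfl (Nat.lt_succ_self r)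
    have h2 := hmax q hq
    omega
  refine isShape_iff.2 fun r c hrc r' c' hr hc => ?_
  rw [Finset.mem_sdiff] at hrc ⊢
  refine ⟨hS' _ _ hrc.1 _ _ hr hc, fun hp' => hrc.2 ?_⟩
  obtain ⟨i, rfl⟩ := Nat.exists_eq_add_of_le hr
  obtain ⟨j, rfl⟩ := Nat.exists_eq_add_of_le hc
  -- A path to the right and then down, from a cell of `p` to a cell of `S`, never leaves `p`.
  have h1 : ∀ j' ≤ j, (r', c' + j') ∈ p.1.cells := by
    intro j' hj
    induction j' with
    | zero => exact hp'
    | succ k ih =>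
      exact hright _ _ (ih (by omega))
        (hS' _ _ hrc.1 _ _ (by omega) (show c' + (k + 1) ≤ c' + j by omega))
  have h2 : ∀ i' ≤ i, (r' + i', c' + j) ∈ p.1.cells := by
    intro i' hi
    induction i' with
    | zero => exact h1 j le_rfl
    | succ k ih =>
      exact hdown _ _ (ih (by omega))
        (hS' _ _ hrc.1 _ _ (show r' + (k + 1) ≤ r' + i by omega) (by omega))
  exact h2 i le_rfl

/-- Standardisation: the domino that is maximal for the label, then for the diagonal, can be removed
so that a shape remains, and this is repeated. -/
theorem exists_sortedGrowth (T : Filling) (S : Finset (ℕ × ℕ)) (hS : IsShape S)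
    (h : TilesCells T S) (hT : IsOrdered T) :
    ∃ L, IsSortedGrowth L ∧ L.toFinset = T ∧ listCells L = S := by
  induction hk : T.card generalizing T S with
  | zero =>
    obtain rfl := Finset.card_eq_zero.1 hk
    refine ⟨[], ⟨trivial, List.Pairwise.nil⟩, rfl, ?_⟩
    refine (Finset.eq_empty_of_forall_notMem fun c hc => ?_).symm
    obtain ⟨p, hp, -⟩ := h.2 c hc
    simp at hp
  | succ k ih =>
    obtain ⟨p, hp, hmax⟩ := Finset.exists_max_image T (fun p => toLex (p.2, p.1.diag))
      (Finset.card_pos.1 (by omega))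
    have hmax' : ∀ q ∈ T, q.2 < p.2 ∨ q.2 = p.2 ∧ q.1.diag ≤ p.1.diag :=
      fun q hq => Prod.Lex.toLex_le_toLex.1 (hmax q hq)
    have hS' := hT.isShape_sdiff hS h hp hmax'
    obtain ⟨L, hL, hLT, hLS⟩ := ih (T.erase p) (S \ p.1.cells) hS' (h.erase hp)
      (hT.mono (Finset.erase_subset _ _)) (by rw [Finset.card_erase_of_mem hp]; omega)
    have hunion : S \ p.1.cells ∪ p.1.cells = S := Finset.sdiff_union_of_subset (h.1 p hp)
    have hadd : Addable (listCells L) p.1 := by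
      rw [hLS]
      exact ⟨Finset.disjoint_sdiff, hunion.symm ▸ hS⟩
    refine ⟨p :: L, ⟨⟨hL.growth, hadd⟩, List.pairwise_cons.2 ⟨fun q hq => ?_, hL.sorted⟩⟩, ?_, ?_⟩
    · have hmem : ∀ x ∈ L, x ∈ T := fun x hx =>
        Finset.mem_of_mem_erase (hLT ▸ List.mem_toFinset.2 hx)
      cases L with
      | nil => simp at hq
      -- Strictness is only available for consecutive dominoes, from `Addable.diag_ne`; transitivity
      -- gives the rest.
      | cons x L =>
        have h1 := hmax' x (hmem x (by simp))
        have h2 : Precedes x p := by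
          have := hL.growth.2.diag_ne (DominoList.IsGrowth.isShape hL.growth.1) hadd
          unfold Precedes
          omega
        rcases List.mem_cons.1 hq with rfl | hq
        · exact h2
        · exact ((List.pairwise_cons.1 hL.sorted).1 q hq).trans h2
    · rw [List.toFinset_cons, hLT, Finset.insert_erase hp]
    · rw [← hunion, ← hLS]; rfl

theorem IsSortedGrowth.nodup {L : List (Domino × ℕ)} (hL : IsSortedGrowth L) : L.Nodup :=
  hL.sorted.imp fun {a b} h => by rintro rfl; exact Precedes.irrefl _ h

theorem IsSortedGrowth.eq_of_toFinset {L M : List (Domino × ℕ)} (hL : IsSortedGrowth L)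
    (hM : IsSortedGrowth M) (h : L.toFinset = M.toFinset) : L = M := by
  refine (List.perm_of_nodup_nodup_toFinset_eq hL.nodup hM.nodup h).eq_of_pairwise ?_
    hL.sorted hM.sorted
  intro a b _ _ h1 h2
  exact absurd (h1.trans h2) (Precedes.irrefl _)

theorem IsSortedGrowth.tail {p : Domino × ℕ} {L : List (Domino × ℕ)}
    (h : IsSortedGrowth (p :: L)) :
    IsSortedGrowth L ∧ Addable (listCells L) p.1 ∧ ∀ q ∈ L, Precedes q p :=
  ⟨⟨h.growth.1, (List.pairwise_cons.1 h.sorted).2⟩, h.growth.2, (List.pairwise_cons.1 h.sorted).1⟩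

theorem IsSortedGrowth.isShape {L : List (Domino × ℕ)} (h : IsSortedGrowth L) :
    IsShape (listCells L) := h.growth.isShape

theorem IsSortedGrowth.tiles {L : List (Domino × ℕ)} (hL : IsSortedGrowth L) :
    TilesCells L.toFinset (listCells L) := by
  induction L with
  | nil => exact ⟨by simp, by simp [listCells, DominoList.cells]⟩
  | cons p L ih =>
    obtain ⟨h1, ⟨h2, h2'⟩, h3⟩ := hL.tail
    obtain ⟨h4, h5⟩ := ih h1
    have hc : listCells (p :: L) = listCells L ∪ p.1.cells := rfl
    rw [hc, List.toFinset_cons]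
    refine ⟨fun q hq => ?_, fun c hc => ?_⟩
    · rcases Finset.mem_insert.1 hq with rfl | hq
      · exact Finset.subset_union_right
      · exact (h4 q hq).trans Finset.subset_union_left
    · rcases Finset.mem_union.1 hc with hcL | hc
      · obtain ⟨q, ⟨hq, hqc⟩, huniq⟩ := h5 c hcL
        refine ⟨q, ⟨Finset.mem_insert_of_mem hq, hqc⟩, ?_⟩
        rintro q' ⟨hq', hqc'⟩
        rcases Finset.mem_insert.1 hq' with rfl | hq'
        · exact absurd hcL (Finset.disjoint_left.1 h2 hqc')
        · exact huniq q' ⟨hq', hqc'⟩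
      · refine ⟨p, ⟨Finset.mem_insert_self _ _, hc⟩, ?_⟩
        rintro q' ⟨hq', hqc'⟩
        rcases Finset.mem_insert.1 hq' with rfl | hq'
        · rfl
        · exact absurd (h4 q' hq' hqc') (Finset.disjoint_left.1 h2 hc)

/-- A later domino has no cell weakly above and to the left of a cell of an earlier one. Columns are
strict because contents drop downwards: a later domino below an earlier one in the same column
cannot have the larger diagonal that equal labels would demand. -/
theorem IsSortedGrowth.isOrdered {L : List (Domino × ℕ)} (hL : IsSortedGrowth L) :
    IsOrdered L.toFinset := by
  induction L with
  | nil => exact ⟨by simp, by simp⟩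
  | cons p L ih =>
    obtain ⟨h1, ⟨h2, -⟩, h3⟩ := hL.tail
    have h4 := ih h1
    have h5 := isShape_iff.1 h1.isShape
    have h6 : ∀ q ∈ L, ∀ c ∈ p.1.cells, ∀ d ∈ q.1.cells, ¬ (c.1 ≤ d.1 ∧ c.2 ≤ d.2) := by
      intro q hq c hc d hd hcd
      exact Finset.disjoint_left.1 h2 hc (h5 _ _ (h1.tiles.1 q (List.mem_toFinset.2 hq) hd) _ _
        hcd.1 hcd.2)
    constructor
    · intro q hq q' hq' hne c hc d hd hcd hlt
      rw [List.toFinset_cons, Finset.mem_insert, List.mem_toFinset] at hq hq'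
      rcases hq with rfl | hq <;> rcases hq' with rfl | hq'
      · exact absurd rfl hne
      · exact absurd ⟨hcd.le, hlt.le⟩ (h6 q' hq' c hc d hd)
      · have := h3 q hq
        unfold Precedes at this
        omega
      · exact h4.row_le q (by simpa using hq) q' (by simpa using hq') hne c hc d hd hcd hlt
    · intro q hq q' hq' hne c hc d hd hcd hlt
      rw [List.toFinset_cons, Finset.mem_insert, List.mem_toFinset] at hq hq'
      rcases hq with rfl | hq <;> rcases hq' with rfl | hq'
      · exact absurd rfl hne
      · exact absurd ⟨hlt.le, hcd.le⟩ (h6 q' hq' c hc d hd)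
      · have h7 := h3 q hq
        have h8 := (Domino.diag_le hc).2
        have h9 := (Domino.diag_le hd).1
        unfold Precedes at h7
        omega
      · exact h4.col_lt q (by simpa using hq) q' (by simpa using hq') hne c hc d hd hcd hlt

theorem IsSortedGrowth.card_cells {L : List (Domino × ℕ)} (hL : IsSortedGrowth L) :
    (listCells L).card = 2 * L.length := by
  induction L with
  | nil => rfl
  | cons p L ih =>
    obtain ⟨h1, ⟨h2, -⟩, h3⟩ := hL.tail
    have hc : listCells (p :: L) = listCells L ∪ p.1.cells := rfl
    have hp : p.1.cells.card = 2 := by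
      rw [Domino.cells, Finset.card_pair]
      split_ifs <;> simp
    rw [hc, Finset.card_union_of_disjoint h2.symm, ih h1, hp, List.length_cons]
    ring

/-- The first domino of a growth lies in the corner. -/
theorem IsSortedGrowth.corner {L : List (Domino × ℕ)} (hL : IsSortedGrowth L) (hne : L ≠ [])
    (k : ℕ) : (⟨0, 0, true⟩, k) ∈ L ↔ (L.getLast hne).2 = k ∧ (L.getLast hne).1.diag = -1 := by
  induction L with
  | nil => exact absurd rfl hne
  | cons p L ih =>
    obtain ⟨h1, h2, h3⟩ := hL.tail
    cases L with
    | nil =>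
      obtain ⟨⟨r, c, v⟩, l⟩ := p
      have hemp : ∀ i, rowLength ∅ i = 0 ∧ colLength ∅ i = 0 := by simp [rowLength, colLength]
      have h2 : Addable ∅ ⟨r, c, v⟩ := h2
      cases v with
      | false =>
        obtain ⟨h4, h5, -⟩ := h2.horizontal isShape_empty
        rw [(hemp _).1] at h4
        rw [(hemp _).2] at h5
        subst h4 h5
        simp
      | true =>
        obtain ⟨h4, h5, -⟩ := h2.vertical isShape_empty
        rw [(hemp _).2] at h4
        rw [(hemp _).1] at h5
        subst h4 h5
        simp [eq_comm]
    | cons x L =>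
      have h4 := ih h1 (by simp)
      rw [List.getLast_cons (by simp), ← h4, List.mem_cons, or_iff_right]
      rintro rfl
      obtain ⟨c, hc⟩ : (listCells (x :: L)).Nonempty :=
        x.1.cells_nonempty.mono Finset.subset_union_right
      exact Finset.disjoint_left.1 h2.1 (mem_cells_vertical.2 (Or.inl rfl))
        (isShape_iff.1 h1.isShape c.1 c.2 hc 0 0 (by simp) (by simp))


/-! ### Signed permutations and words -/

namespace SignedPerm

variable {n : ℕ}

theorem mem_Icc {k : ℕ} (hk : k ≤ n) : (k : ℤ) ∈ Finset.Icc (-(n : ℤ)) n := by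
  rw [Finset.mem_Icc]; omega

theorem entry_eq (π : SignedPerm n) {k : ℕ} (hk : k ≤ n) :
    π.entry k = (π.1 ⟨(k : ℤ), mem_Icc hk⟩ : ℤ) := dif_pos _

theorem entry_zero (π : SignedPerm n) : π.entry 0 = 0 := by
  have h := π.2 ⟨((0 : ℕ) : ℤ), mem_Icc (Nat.zero_le n)⟩ ⟨((0 : ℕ) : ℤ), mem_Icc (Nat.zero_le n)⟩
    (by simp)
  rw [← entry_eq π (Nat.zero_le n)] at h
  omega

theorem natAbs_entry_le (π : SignedPerm n) {k : ℕ} (hk : k ≤ n) : (π.entry k).natAbs ≤ n := by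
  rw [entry_eq π hk]
  have := Finset.mem_Icc.1 (π.1 ⟨(k : ℤ), mem_Icc hk⟩).2
  omega

theorem natAbs_entry_injective (π : SignedPerm n) {k l : ℕ} (hk : k ≤ n) (hl : l ≤ n)
    (h : (π.entry k).natAbs = (π.entry l).natAbs) : k = l := by
  have hm : -(l : ℤ) ∈ Finset.Icc (-(n : ℤ)) n := by rw [Finset.mem_Icc]; omega
  have h1 := π.2 ⟨(l : ℤ), mem_Icc hl⟩ ⟨-(l : ℤ), hm⟩ rfl
  rw [entry_eq π hk, entry_eq π hl, Int.natAbs_eq_natAbs_iff, ← h1] at h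
  rcases h with h | h
  · have := congrArg Subtype.val (π.1.injective (Subtype.ext h))
    simp only at this
    omega
  · have := congrArg Subtype.val (π.1.injective (Subtype.ext h))
    simp only at this
    omega

theorem one_le_natAbs_entry (π : SignedPerm n) {k : ℕ} (hk : k ≤ n) (h0 : 1 ≤ k) :
    1 ≤ (π.entry k).natAbs := by
  by_contra h
  have := π.natAbs_entry_injective hk (Nat.zero_le n) (by rw [entry_zero]; omega)
  omega

theorem ext_entry {π σ : SignedPerm n} (h : ∀ k, 1 ≤ k → k ≤ n → π.entry k = σ.entry k) :
    π = σ := by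
  have h' : ∀ k, k ≤ n → π.entry k = σ.entry k := fun k hk => by
    rcases Nat.eq_zero_or_pos k with rfl | h0
    · rw [entry_zero, entry_zero]
    · exact h k h0 hk
  refine Subtype.ext (Equiv.ext fun x => Subtype.ext ?_)
  obtain ⟨x, hx⟩ := x
  have hxn := Finset.mem_Icc.1 hx
  obtain ⟨k, rfl | rfl⟩ := Int.eq_nat_or_neg x
  · have hk : k ≤ n := by omega
    rw [← entry_eq π hk, ← entry_eq σ hk, h' k hk]
  · have hk : k ≤ n := by omega
    rw [π.2 ⟨(k : ℤ), mem_Icc hk⟩ ⟨-(k : ℤ), hx⟩ rfl, σ.2 ⟨(k : ℤ), mem_Icc hk⟩ ⟨-(k : ℤ), hx⟩ rfl,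
      ← entry_eq π hk, ← entry_eq σ hk, h' k hk]

theorem exists_of_entries (g : ℕ → ℤ) (h1 : ∀ k, 1 ≤ k → k ≤ n → 1 ≤ (g k).natAbs ∧ (g k).natAbs ≤ n)
    (h2 : ∀ k l, 1 ≤ k → k ≤ n → 1 ≤ l → l ≤ n → (g k).natAbs = (g l).natAbs → k = l) :
    ∃ π : SignedPerm n, ∀ k, 1 ≤ k → k ≤ n → π.entry k = g k := by
  -- The odd extension; being injective on a finite set, it is a permutation.
  let G : ℤ → ℤ := fun x => if 0 < x then g x.natAbs else if x < 0 then -g x.natAbs else 0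
  have hG : ∀ x ∈ Finset.Icc (-(n : ℤ)) n, G x ∈ Finset.Icc (-(n : ℤ)) n := by
    intro x hx
    rw [Finset.mem_Icc] at hx ⊢
    have := h1 x.natAbs
    simp only [G]
    split_ifs <;> omega
  have hinj : ∀ x ∈ Finset.Icc (-(n : ℤ)) n, ∀ y ∈ Finset.Icc (-(n : ℤ)) n, G x = G y → x = y := by
    intro x hx y hy hxy
    rw [Finset.mem_Icc] at hx hy
    have hx1 := h1 x.natAbs
    have hy1 := h1 y.natAbs
    have h3 := h2 x.natAbs y.natAbs
    by_cases hab : x.natAbs = y.natAbs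
    · simp only [G, hab] at hxy
      rw [hab] at hx1
      split_ifs at hxy <;> omega
    · simp only [G] at hxy
      split_ifs at hxy <;> omega
  let F : Finset.Icc (-(n : ℤ)) n → Finset.Icc (-(n : ℤ)) n := fun x => ⟨G x.1, hG x.1 x.2⟩
  have hF : Function.Injective F := fun x y hxy =>
    Subtype.ext (hinj _ x.2 _ y.2 (congrArg Subtype.val hxy))
  let π : SignedPerm n := ⟨Equiv.ofBijective F (Finite.injective_iff_bijective.1 hF), by
    intro i j hij
    simp only [Equiv.ofBijective_apply, F, G, hij, Int.natAbs_neg]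
    split_ifs <;> omega⟩
  refine ⟨π, fun k hk hkn => ?_⟩
  rw [entry_eq π hkn]
  change G k = g k
  simp only [G, Int.natAbs_natCast]
  rw [if_pos (by omega)]

/-- The word `π(1), …, π(n)`. -/
noncomputable def word (π : SignedPerm n) : List ℤ := (List.range n).map fun i => π.entry (i + 1)

theorem length_word (π : SignedPerm n) : π.word.length = n := by simp [word]

theorem word_letters (π : SignedPerm n) :
    (∀ a ∈ π.word.reverse, 1 ≤ a.natAbs ∧ a.natAbs ≤ n) ∧
      (π.word.reverse.map Int.natAbs).Nodup := by
  constructor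
  · intro a ha
    rw [List.mem_reverse, word, List.mem_map] at ha
    obtain ⟨k, hk, rfl⟩ := ha
    rw [List.mem_range] at hk
    exact ⟨π.one_le_natAbs_entry hk (by omega), π.natAbs_entry_le hk⟩
  · rw [List.map_reverse, List.nodup_reverse, word, List.map_map]
    refine List.Nodup.map_on (fun k hk l hl h => ?_) List.nodup_range
    rw [List.mem_range] at hk hl
    have := π.natAbs_entry_injective hk hl h
    omega

theorem word_injective {π σ : SignedPerm n} (h : π.word = σ.word) : π = σ := by
  refine ext_entry fun k hk hkn => ?_
  have := List.map_inj_left.1 h (k - 1) (List.mem_range.2 (by omega))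
  simpa [Nat.sub_add_cancel hk] using this

theorem exists_word (w : List ℤ) (hn : w.length = n)
    (h1 : ∀ a ∈ w, 1 ≤ a.natAbs ∧ a.natAbs ≤ n) (h2 : (w.map Int.natAbs).Nodup) :
    ∃ π : SignedPerm n, π.word = w := by
  have hget : ∀ k, (h0 : 1 ≤ k) → (hk : k ≤ n) → w.getD (k - 1) 0 = w[k - 1]'(by omega) := fun k h0 hk =>
    List.getD_eq_getElem _ _ (by omega)
  obtain ⟨π, hπ⟩ := exists_of_entries (n := n) (fun k => w.getD (k - 1) 0)
    (fun k h0 hk => by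
      rw [hget k h0 hk]; exact h1 _ (List.getElem_mem _))
    (fun k l hk hkn hl hln h => by
      rw [hget k hk hkn, hget l hl hln] at h
      have := (h2.getElem_inj_iff (i := k - 1) (j := l - 1) (hi := by rw [List.length_map]; omega)
        (hj := by rw [List.length_map]; omega)).1 (by simpa using h)
      omega)
  refine ⟨π, List.ext_getElem (by rw [length_word, hn]) fun k hk hk' => ?_⟩
  simp only [word, List.getElem_map, List.getElem_range]
  rw [hπ (k + 1) (by omega) (by omega), hget (k + 1) (by omega) (by omega)]
  simp

end SignedPerm

/-! ### Standard tableaux as lists -/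

theorem DominoList.filling_of_labels (n : ℕ) (L : List (Domino × ℕ))
    (h : L.map Prod.snd = (List.range' 1 n).reverse) :
    DominoList.filling (L.map fun p => some p.1) = L.toFinset := by
  induction n generalizing L with
  | zero => simp at h; subst h; rfl
  | succ n ih =>
    rw [List.range'_1_concat, List.reverse_append, List.reverse_singleton, List.singleton_append] at h
    cases L with
    | nil => simp at h
    | cons p L =>
      rw [List.map_cons, List.cons.injEq] at h
      have hlen : L.length = n := by simpa using congrArg List.length h.2
      rw [List.map_cons, DominoList.filling, List.toFinset_cons, ih L h.2, List.length_map, hlen,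
        add_comm n 1, ← h.1]

theorem IsStandard.isOrdered {n : ℕ} {lam : YoungDiagram} {T : Filling} (h : IsStandard n lam T) :
    IsOrdered T :=
  ⟨fun p hp q hq hne c hc d hd h1 h2 => (h.row_lt p hp q hq hne c hc d hd h1 h2).le, h.col_lt⟩

/-- A standard tableau is also ordered in the semistandard sense, and in its sorted growth distinct
labels force the label sequence `n, …, 1`. -/
theorem IsStandard.exists_list {n : ℕ} {lam : YoungDiagram} {T : Filling}
    (h : IsStandard n lam T) :
    ∃ Z : List Domino, DominoList.IsGrowth (Z.map some) ∧ Z.length = n ∧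
      DominoList.filling (Z.map some) = T ∧ DominoList.cells (Z.map some) = lam.cells ∧
      lam.card = 2 * n := by
  obtain ⟨L, hL, hLT, hLS⟩ := exists_sortedGrowth T lam.cells lam.isLowerSet h.tiles h.isOrdered
  have hmem : ∀ p, p ∈ L ↔ p ∈ T := fun p => by rw [← hLT, List.mem_toFinset]
  have hlab : L.map Prod.snd = (List.range' 1 n).reverse := by
    have h1 : (L.map Prod.snd).Pairwise (· > ·) := by
      rw [List.pairwise_map]
      refine hL.sorted.imp_of_mem fun {p q} hp hq hpq => ?_
      rw [hmem] at hp hq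
      rcases hpq with hlt | ⟨heq, hlt⟩
      · exact hlt
      · have := (h.label_unique p.2 (h.label_mem p hp)).unique ⟨hp, rfl⟩ ⟨hq, heq⟩
        subst this
        exact absurd hlt (lt_irrefl _)
    have h2 : ((List.range' 1 n).reverse).Pairwise (· > ·) := by
      rw [List.pairwise_reverse]
      exact List.pairwise_lt_range'
    refine h1.eq_of_mem_iff h2 fun k => ?_
    rw [List.mem_map, List.mem_reverse, List.mem_range'_1]
    constructor
    · rintro ⟨p, hp, rfl⟩
      have := Finset.mem_Icc.1 (h.label_mem p ((hmem p).1 hp))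
      omega
    · intro hk
      obtain ⟨p, ⟨hp, hpk⟩, -⟩ := h.label_unique k (Finset.mem_Icc.2 (by omega))
      exact ⟨p, (hmem p).2 hp, hpk⟩
  have hlen : L.length = n := by simpa using congrArg List.length hlab
  have hmap : (L.map Prod.fst).map some = L.map fun p => some p.1 := by simp
  refine ⟨L.map Prod.fst, hmap ▸ hL.growth, by simpa using hlen, ?_, hmap ▸ hLS, ?_⟩
  · rw [hmap, DominoList.filling_of_labels n L hlab, hLT]
  · rw [YoungDiagram.card, ← hLS, hL.card_cells, hlen]

theorem card_labelSet_map_some (q : List ℤ) : (labelSet (q.map some)).card = q.length := by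
  induction q with
  | nil => rfl
  | cons e q ih =>
    have : (q.map some).length + 1 ∉ labelSet (q.map some) := fun h => by
      have := labelSet_subset _ _ h
      omega
    rw [List.map_cons, labelSet, Finset.card_insert_of_notMem this, ih, List.length_cons]

theorem moves_map_some (Z : List Domino) :
    DominoList.moves (Z.map some) = (Z.map Domino.diag).map some := by
  simp [DominoList.moves]

/-- The recording tableau `Y` of a signed permutation with insertion tableau `Z`; both are given by
their dominoes, the last one first. -/
def Records {n : ℕ} (Z : List Domino) (π : SignedPerm n) (Y : List Domino) : Prop :=
  RobinsonSchensted n π.word.reverse (DominoList.moves (Z.map some)) (Y.map Domino.diag) ∧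
    DominoList.IsGrowth (Y.map some)

theorem exists_records {n : ℕ} {Z : List Domino} (hn : Z.length = n) (π : SignedPerm n)
    (hπ : π ∈ knuthClass n (DominoList.filling (Z.map some))) :
    ∃ Y, Records Z π Y ∧ Y.length = n ∧
      DominoList.cells (Y.map some) = DominoList.cells (Z.map some) := by
  obtain ⟨t, q, h⟩ := RobinsonSchensted.exists_of_word n _ π.word_letters.1 π.word_letters.2
  obtain ⟨X, Y, h1, rfl, h3, h4, rfl, h6, h7⟩ := DominoList.exists_insertWord h
  rw [List.reverse_reverse] at h7
  have hX : X = Z.map some :=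
    DominoList.filling_injective (by simp [h3, hn]) (h7.symm.trans hπ)
  subst hX
  refine ⟨Y, ⟨h, h4⟩, ?_, h6⟩
  simpa [π.length_word] using h.length_moves

/-- Surjectivity of the correspondence: every growth of the right shape is the recording tableau of
some member of the class. -/
theorem exists_of_records {n : ℕ} {Z Y : List Domino} (hZ : DominoList.IsGrowth (Z.map some))
    (hn : Z.length = n) (hY : DominoList.IsGrowth (Y.map some)) (hYn : Y.length = n)
    (hc : DominoList.cells (Y.map some) = DominoList.cells (Z.map some)) :
    ∃ π : SignedPerm n, π ∈ knuthClass n (DominoList.filling (Z.map some)) ∧ Records Z π Y := by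
  obtain ⟨w, h⟩ := RobinsonSchensted.exists_of_tableaux n (Y.map Domino.diag)
    (DominoList.moves (Z.map some)) (by simp [DominoList.moves, hn]) hZ.validMoves
    (moves_map_some Y ▸ hY.validMoves)
    (by rw [← moves_map_some, ← hZ.beads_cells, ← hY.beads_cells, hc])
    (by rw [moves_map_some, card_labelSet_map_some]; simp [hn, hYn])
  obtain ⟨π, hπ⟩ := SignedPerm.exists_word w.reverse
    (by rw [List.length_reverse, ← h.length_moves, List.length_map, hYn])
    (by simpa using h.letters.1) (by simpa using h.letters.2.1)
  refine ⟨π, ?_, by rw [hπ, List.reverse_reverse]; exact h, hY⟩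
  obtain ⟨X, -, h1, h2, -, -, -, -, h3⟩ := DominoList.exists_insertWord h
  rw [h1.eq_of_moves hZ h2, ← hπ] at h3
  exact h3

/-! ### Chow's sequences as labellings of recording tableaux -/

/-- The list `i_n, …, i_1`. -/
def seqLabels {n : ℕ} (i : Fin (n + 1) → ℕ) : List ℕ := (List.ofFn fun k : Fin n => i k.succ).reverse

theorem length_seqLabels {n : ℕ} (i : Fin (n + 1) → ℕ) : (seqLabels i).length = n := by
  simp [seqLabels]

theorem getElem_seqLabels {n : ℕ} (i : Fin (n + 1) → ℕ) (j : ℕ) (hj : j < n) :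
    (seqLabels i)[j]'(by rwa [length_seqLabels]) = i ⟨n - j, by omega⟩ := by
  simp only [seqLabels, List.getElem_reverse, List.getElem_ofFn]
  congr 1
  ext
  simp
  omega

theorem exists_seqLabels {n : ℕ} (l : List ℕ) (hl : l.length = n) :
    ∃ i : Fin (n + 1) → ℕ, i 0 = 0 ∧ seqLabels i = l := by
  refine ⟨Fin.cons 0 fun k => l.reverse[k]'(by simp [hl]), rfl, ?_⟩
  rw [seqLabels, List.reverse_eq_iff]
  refine List.ext_getElem (by simp [hl]) fun k hk hk' => ?_
  simp

theorem seqLabels_injective {n : ℕ} {i i' : Fin (n + 1) → ℕ} (h0 : i 0 = i' 0)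
    (h : seqLabels i = seqLabels i') : i = i' := by
  rw [seqLabels, seqLabels, List.reverse_inj, List.ofFn_inj] at h
  funext k
  refine Fin.cases h0 (fun j => ?_) k
  exact congrFun h j

/-- The recording tableau with its dominoes labelled by a sequence. -/
def labelled {n : ℕ} (Y : List Domino) (i : Fin (n + 1) → ℕ) : List (Domino × ℕ) :=
  Y.zip (seqLabels i)

section Labelled

variable {n : ℕ} {Y : List Domino} {i : Fin (n + 1) → ℕ}

theorem map_fst_labelled (hY : Y.length = n) : (labelled Y i).map Prod.fst = Y :=
  List.map_fst_zip (by rw [length_seqLabels, hY])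

theorem map_snd_labelled (hY : Y.length = n) : (labelled Y i).map Prod.snd = seqLabels i :=
  List.map_snd_zip (by rw [length_seqLabels, hY])

theorem map_some_labelled (hY : Y.length = n) :
    (labelled Y i).map (fun p => some p.1) = Y.map some := by
  conv_rhs => rw [← map_fst_labelled (i := i) hY, List.map_map]
  rfl

theorem length_labelled (hY : Y.length = n) : (labelled Y i).length = n := by
  simp [labelled, length_seqLabels, hY]

theorem weight_labelled (hY : Y.length = n) (hnd : (labelled Y i).Nodup) :
    Filling.weight (labelled Y i).toFinset = sequenceWeight i := by
  rw [Filling.weight, List.sum_toFinset _ hnd, sequenceWeight]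
  have : (labelled Y i).map (fun p => (Finsupp.single p.2 1 : ℕ →₀ ℕ)) =
      (seqLabels i).map fun k => Finsupp.single k 1 := by
    rw [← map_snd_labelled (i := i) hY, List.map_map]
    rfl
  rw [this, seqLabels, List.map_reverse, List.sum_reverse, List.map_ofFn, List.sum_ofFn]
  rfl

/-- A sequence is compatible with the descents of `π` if and only if it turns the recording tableau
into a semistandard tableau. -/
theorem mem_chowSequences_iff {Z : List Domino} {π : SignedPerm n} (h : Records Z π Y)
    (hY : Y.length = n) (hi : i 0 = 0) :
    i ∈ chowSequences n π.descents ↔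
      IsSortedGrowth (labelled Y i) ∧ ((⟨0, 0, true⟩ : Domino), 0) ∉ labelled Y i := by
  obtain ⟨h, hg⟩ := h
  have hlen := length_labelled (i := i) hY
  have hwl : π.word.reverse.length = n := by rw [List.length_reverse, π.length_word]
  have hw : ∀ j (hj : j < n), π.word.reverse[j]'(by rwa [hwl]) = π.entry (n - j) := fun j hj => by
    simp only [SignedPerm.word, List.getElem_reverse, List.getElem_map, List.getElem_range,
      List.length_map, List.length_range]
    congr 1
    omega
  -- Since `Precedes` is transitive, sortedness is a condition on neighbours: labels weakly
  -- increase, and may be equal only if the diagonals increase, that is, if there is no descent. All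
  -- lists run backwards, whence the indices `n - j`.
  have hchain : (∀ k : ℕ, 1 ≤ k → (hk : k < n) → i ⟨k, by omega⟩ ≤ i ⟨k + 1, by omega⟩ ∧
      (k ∈ π.descents → i ⟨k, by omega⟩ < i ⟨k + 1, by omega⟩)) ↔
      IsSortedGrowth (labelled Y i) := by
    have h1 : IsSortedGrowth (labelled Y i) ↔
        (labelled Y i).IsChain fun p q => Precedes q p := by
      have : IsTrans (Domino × ℕ) fun p q => Precedes q p := ⟨fun _ _ _ h h' => h'.trans h⟩
      rw [List.isChain_iff_pairwise]
      exact ⟨fun h => h.sorted, fun h => ⟨map_some_labelled (i := i) hY ▸ hg, h⟩⟩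
    rw [h1, List.isChain_iff_getElem]
    have key : ∀ j (hj : j + 1 < n),
        (Precedes ((labelled Y i)[j + 1]'(by omega)) ((labelled Y i)[j]'(by omega)) ↔
          i ⟨n - j - 1, by omega⟩ ≤ i ⟨n - j, by omega⟩ ∧
            (n - j - 1 ∈ π.descents → i ⟨n - j - 1, by omega⟩ < i ⟨n - j, by omega⟩)) := by
      intro j hj
      have h2 := h.getElem_lt_iff j (by rw [hwl]; exact hj) (by simpa [hY] using hj)
      rw [hw _ hj, hw _ (by omega)] at h2
      simp only [List.getElem_map] at h2
      have h3 : n - j - 1 ∈ π.descents ↔ π.entry (n - j) < π.entry (n - (j + 1)) := by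
        rw [SignedPerm.descents, Finset.mem_filter, Finset.mem_range,
          show n - j - 1 + 1 = n - j by omega, show n - (j + 1) = n - j - 1 by omega]
        exact and_iff_right (by omega)
      have h4 : π.entry (n - j) ≠ π.entry (n - (j + 1)) := fun heq => by
        have := π.natAbs_entry_injective (by omega) (by omega) (congrArg Int.natAbs heq)
        omega
      have h5 : ((labelled Y i)[j + 1]'(by omega)).2 = i ⟨n - j - 1, by omega⟩ := by
        simp only [labelled, List.getElem_zip]
        exact getElem_seqLabels i (j + 1) hj
      have h6 : ((labelled Y i)[j]'(by omega)).2 = i ⟨n - j, by omega⟩ := by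
        simp only [labelled, List.getElem_zip]
        exact getElem_seqLabels i j (by omega)
      rw [Precedes, h5, h6, h3]
      simp only [labelled, List.getElem_zip, ← h2]
      omega
    constructor
    · intro hk j hj
      rw [key j (by omega)]
      have := hk (n - j - 1) (by omega) (by omega)
      simpa only [show n - j - 1 + 1 = n - j by omega] using this
    · intro hc k hk hkn
      have := (key (n - k - 1) (by omega)).1 (hc (n - k - 1) (by omega))
      simpa only [show n - (n - k - 1) - 1 = k by omega, show n - (n - k - 1) = k + 1 by omega,
        Nat.add_sub_cancel] using this
  -- Position 0 is split off. There the weak inequality is automatic, and only strictness at a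
  -- descent remains, to be matched with the corner condition.
  have hmem : i ∈ chowSequences n π.descents ↔
      (∀ k : ℕ, 1 ≤ k → (hk : k < n) → i ⟨k, by omega⟩ ≤ i ⟨k + 1, by omega⟩ ∧
        (k ∈ π.descents → i ⟨k, by omega⟩ < i ⟨k + 1, by omega⟩)) ∧
      ∀ hn : 0 < n, 0 ∈ π.descents → 0 < i ⟨1, by omega⟩ := by
    constructor
    · rintro ⟨-, h1, h2⟩
      exact ⟨fun k _ hk => ⟨h1 ⟨k, hk⟩, h2 ⟨k, hk⟩⟩, fun hn h0 => hi ▸ h2 ⟨0, hn⟩ h0⟩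
    · rintro ⟨h1, h2⟩
      refine ⟨hi, fun j => ?_, fun j hj => ?_⟩
      · obtain ⟨k, hk⟩ := j
        rcases Nat.eq_zero_or_pos k with rfl | h0
        · exact (Nat.zero_le _).trans' hi.le
        · exact (h1 k h0 hk).1
      · obtain ⟨k, hk⟩ := j
        rcases Nat.eq_zero_or_pos k with rfl | h0
        · exact lt_of_eq_of_lt hi (h2 hk hj)
        · exact (h1 k h0 hk).2 hj
  rw [hmem, hchain]
  refine and_congr_right fun hsg => ?_
  rcases Nat.eq_zero_or_pos n with rfl | hn
  · have : labelled Y i = [] := List.length_eq_zero_iff.1 hlen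
    exact ⟨fun _ => by simp [this], fun _ h => absurd h (lt_irrefl _)⟩
  · have hne : labelled Y i ≠ [] := List.ne_nil_of_length_pos (by omega)
    have hwne : π.word.reverse ≠ [] := List.ne_nil_of_length_pos (by omega)
    have hYne : Y.map Domino.diag ≠ [] := List.ne_nil_of_length_pos (by simp; omega)
    rw [hsg.corner hne]
    have h1 := h.first_neg_iff hwne hYne
    have h2 : π.word.reverse.getLast hwne = π.entry 1 := by
      rw [List.getLast_eq_getElem]
      simp only [hwl]
      rw [hw _ (by omega)]
      congr 1
      omega
    have h3 : ((labelled Y i).getLast hne).2 = i ⟨1, by omega⟩ := by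
      rw [List.getLast_eq_getElem]
      simp only [labelled, List.getElem_zip]
      rw [getElem_seqLabels i _ (by simp [length_seqLabels]; omega)]
      congr 2
      simp [length_seqLabels, hY]
      omega
    have h4 : ((labelled Y i).getLast hne).1.diag = (Y.map Domino.diag).getLast hYne := by
      rw [List.getLast_eq_getElem, List.getLast_eq_getElem]
      simp [labelled, length_seqLabels, hY]
    have h5 : 0 ∈ π.descents ↔ π.entry 1 < 0 := by
      rw [SignedPerm.descents, Finset.mem_filter, Finset.mem_range, π.entry_zero]
      exact and_iff_right hn
    rw [h3, h4, ← h1, h2, ← h5]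
    constructor
    · rintro h ⟨h6, h7⟩
      have := h hn h7
      omega
    · intro h _ h7
      by_contra h6
      exact h ⟨by omega, h7⟩

end Labelled

/-! ### The bijection with semistandard tableaux -/

theorem isSemistandard_iff {lam : YoungDiagram} {U : Filling} :
    IsSemistandard lam U ↔ TilesCells U lam.cells ∧ IsOrdered U ∧ (⟨0, 0, true⟩, 0) ∉ U :=
  ⟨fun h => ⟨h.tiles, ⟨h.row_le, h.col_lt⟩, h.corner⟩,
    fun h => ⟨h.1, h.2.1.row_le, h.2.1.col_lt, h.2.2⟩⟩

/-- Coefficients are compared by the bijection sending a permutation and a compatible sequence to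
the recording tableau labelled by the sequence; standardisation is its inverse. -/
theorem quasisym_knuthClass (n : ℕ) (lam : YoungDiagram) (T : Filling) (hT : IsStandard n lam T) :
    quasisym (knuthClass n T) = dominoFunction lam := by
  classical
  obtain ⟨Z, hZ, hZn, rfl, hZc, hcard⟩ := hT.exists_list
  have hex := exists_records hZn
  choose! Y hYr hYn hYc using hex
  funext m
  have hsum : quasisym (knuthClass n (DominoList.filling (Z.map some))) m =
      ∑ π ∈ Finset.univ.filter (fun π => π ∈ knuthClass n (DominoList.filling (Z.map some))),
        chowF n (SignedPerm.descents π) m := by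
    change MvPowerSeries.coeff m (quasisym _) = ∑ π ∈ _, MvPowerSeries.coeff m (chowF n _)
    rw [quasisym, map_sum]
  rw [hsum]
  simp only [chowF, dominoFunction, genFun]
  rw [← Nat.cast_sum]
  congr 1
  have hfin : {U | U ∈ {U | IsSemistandard lam U} ∧ Filling.weight U = m}.Finite :=
    semistandard_finite lam m
  simp only [Set.ncard_eq_toFinset_card _ (chowSequences_finite _ _ _)]
  rw [Set.ncard_eq_toFinset_card _ hfin, ← Finset.card_sigma]
  refine Finset.card_bij (fun (x : (_ : SignedPerm n) × (Fin (n + 1) → ℕ)) _ => (labelled (Y x.1) x.2).toFinset) ?_ ?_ ?_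
  · rintro ⟨π, i⟩ hx
    simp only [Finset.mem_sigma, Finset.mem_filter, Finset.mem_univ, true_and,
      Set.Finite.mem_toFinset] at hx
    obtain ⟨hπ, hi, hm⟩ := hx
    obtain ⟨h1, h2⟩ := (mem_chowSequences_iff (hYr π hπ) (hYn π hπ) hi.1).1 hi
    have hc : listCells (labelled (Y π) i) = lam.cells := by
      rw [listCells, map_some_labelled (hYn π hπ), hYc π hπ, hZc]
    rw [Set.Finite.mem_toFinset]
    refine ⟨isSemistandard_iff.2 ⟨hc ▸ h1.tiles, h1.isOrdered, by simpa using h2⟩, ?_⟩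
    rw [weight_labelled (hYn π hπ) h1.nodup, hm]
  · rintro ⟨π, i⟩ hx ⟨σ, j⟩ hy hxy
    simp only [Finset.mem_sigma, Finset.mem_filter, Finset.mem_univ, true_and,
      Set.Finite.mem_toFinset] at hx hy hxy
    obtain ⟨hπ, hi, -⟩ := hx
    obtain ⟨hσ, hj, -⟩ := hy
    have h1 := ((mem_chowSequences_iff (hYr π hπ) (hYn π hπ) hi.1).1 hi).1
    have h2 := ((mem_chowSequences_iff (hYr σ hσ) (hYn σ hσ) hj.1).1 hj).1
    have h3 := h1.eq_of_toFinset h2 hxy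
    have h4 : Y π = Y σ := by
      rw [← map_fst_labelled (i := i) (hYn π hπ), h3, map_fst_labelled (hYn σ hσ)]
    have h5 : i = j := seqLabels_injective (hi.1.trans hj.1.symm) (by
      rw [← map_snd_labelled (i := i) (hYn π hπ), h3, map_snd_labelled (hYn σ hσ)])
    have h6 := (hYr π hπ).1.unique (h4 ▸ (hYr σ hσ).1)
    obtain rfl := SignedPerm.word_injective (List.reverse_inj.1 h6)
    rw [h5]
  · intro U hU
    rw [Set.Finite.mem_toFinset] at hU
    obtain ⟨hU, hm⟩ := hU
    obtain ⟨h1, h2, h3⟩ := isSemistandard_iff.1 hU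
    obtain ⟨L, hL, rfl, hLc⟩ := exists_sortedGrowth U lam.cells lam.isLowerSet h1 h2
    have hLn : L.length = n := by
      have := hL.card_cells
      rw [hLc] at this
      have h4 : lam.cells.card = 2 * n := hcard
      omega
    have hmap : (L.map Prod.fst).map some = L.map fun p => some p.1 := by simp
    obtain ⟨π, hπ, hr⟩ := exists_of_records (Y := L.map Prod.fst) hZ hZn (hmap ▸ hL.growth)
      (by simpa using hLn) (by rw [hmap, hZc]; exact hLc)
    obtain ⟨i, hi0, hi⟩ := exists_seqLabels (L.map Prod.snd) (by simpa using hLn)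
    -- The recording tableau chosen for `π` agrees with the prescribed one, because insertion is a
    -- function of the word and a growth is determined by its moves.
    have hYeq : Y π = L.map Prod.fst := by
      have h5 := (hYr π hπ).1.functional hr.1
      refine List.map_injective_iff.2 (Option.some_injective _)
        ((hYr π hπ).2.eq_of_moves hr.2 ?_)
      rw [moves_map_some, moves_map_some, h5.2]
    have hlab : labelled (Y π) i = L := by
      rw [labelled, hYeq, hi]
      exact (List.zip_of_prod rfl rfl).symm
    refine ⟨⟨π, i⟩, ?_, by simp only [hlab]⟩
    simp only [Finset.mem_sigma, Finset.mem_filter, Finset.mem_univ, true_and,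
      Set.Finite.mem_toFinset]
    refine ⟨hπ, (mem_chowSequences_iff (hYr π hπ) (hYn π hπ) hi0).2 ?_, ?_⟩
    · rw [hlab]
      exact ⟨hL, by simpa using h3⟩
    · rw [← weight_labelled (i := i) (hYn π hπ) (hlab ▸ hL.nodup), hlab, hm]

theorem gPositive_knuthClass (n : ℕ) (lam : YoungDiagram) (T : Filling)
    (hT : IsStandard n lam T) : GPositive (knuthClass n T) := by
  classical
  obtain ⟨-, -, -, -, -, hcard⟩ := hT.exists_list
  refine ⟨Finsupp.single lam 1, fun μ hμ => ?_, ?_⟩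
  · obtain rfl : μ = lam := by
      by_contra hne
      rw [Finset.mem_coe, Finsupp.mem_support_iff, Finsupp.single_apply, if_neg (Ne.symm hne)] at hμ
      exact hμ rfl
    exact ⟨hcard, T, hT⟩
  · rw [quasisym_knuthClass n lam T hT, Finsupp.sum_single_index] <;> simp

end TypeBKnuth

theorem mainTheorem8 (n : ℕ) (lam : YoungDiagram) (T : TypeBKnuth.Filling)
    (hT : TypeBKnuth.IsStandard n lam T) :
    TypeBKnuth.GPositive (TypeBKnuth.knuthClass n T) ∧
      TypeBKnuth.quasisym (TypeBKnuth.knuthClass n T) = TypeBKnuth.dominoFunction lam :=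
  ⟨TypeBKnuth.gPositive_knuthClass n lam T hT, TypeBKnuth.quasisym_knuthClass n lam T hT⟩
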